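/- **Model.** Let $G$ be an undirected graph on $n\ge 2$ nodes with nonnegative edge lengths $\ell$; the nodes have distinct identifiers in $\{0,\dots,n^{c}\}$, $c$ a constant; $\log=\log_2$. Distances $d_H$ in a subgraph $H\subseteq G$ are shortest-path distances ($\infty$ between different components), $B_G(v,D)=\{u : d_G(v,u)\le D\}$, and for sources $S\subseteq V(H)$ with delays $\mathrm{del}\ge 0$ we write $d_{H,\mathrm{del}}(S,v)=\min_{q\in S}(\mathrm{del}(q)+d_H(q,v))$. Initially each node knows $n$, $D$, its identifier, and the identifiers of its neighbours with the lengths of the connecting edges. A *step* of an algorithm is one of the following; local computation is free and all nodes know which step is performed. * A message round: every node sends to each neighbour a message of $O(\log n)$ bits. * A call of the distance oracle with precision parameter $\varepsilon\ge0$ and distance parameter $R\ge0$: for a subgraph $H\subseteq G$ and sources $S\subseteq V(H)$ with delays, all given distributedly, it returns some rooted forest $F\subseteq H$, every node learning whether it is in $F$ and its parent, such that every $v\in V(F)$ has its root $q$ in $S$ and $\mathrm{del}(q)+d_F(q,v)\le(1+\varepsilon)\,d_{H,\mathrm{del}}(S,v)$, and every $v\in V(H)$ with $d_{H,\mathrm{del}}(S,v)\le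 R$ lies in $V(F)$. Nothing else is assumed about the answer. * A call of the forest aggregation oracle with distance parameter $R$: for a rooted forest $F\subseteq G$ in which every node has distance at most $R$ from its root, and integers $0\le x_v\le n^{O(1)}$, each node learns the sum of the $x_u$ over its ancestors and over its descendants (itself included). * A call of the global aggregation oracle: for integers $0\le x_v\le n^{O(1)}$, all nodes learn $\sum_v x_v$. **Statement.** Consider the following problem. The input is a weighted graph $G$ as above and a parameter $D>0$; in the deterministic version each node $v$ also has an integer weight $\mu(v)\in\{0,\dots,n^{c}\}$, and in the randomized version each node has private independent fair random bits, of which the oracle answers are independent. The output is a partition $\mathcal C$ of $V(G)$ (each node outputs the name of its cluster) together with a partition $V(G)=V^{\mathrm{good}}\sqcup V^{\mathrm{bad}}$ such that 1. every cluster $C\in\mathcal C$ has diameter $\operatorname{diam}(G[C])=O(D\log^3 n)$, distances being measured in the induced subgraph $G[C]$; 2. for every $v\in V^{\mathrm{good}}$ there is $C\in\mathcal C$ with $B_G(v,D)\subseteq C$; 3. in the deterministic version, $\mu(V^{\mathrm{bad}})\le 0.1\cdot\mu(V(G))$; 4. in the randomized version, $\Pr[v\in V^{\mathrm{bad}}]\le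 0.1$ for every $v\in V(G)$. There is a deterministic and a randomized algorithm that solves (its version of) the problem in $O(\log^3 n)$ steps, performing all distance-oracle calls with precision parameter exactly $\varepsilon=1/\log^2 n$ and all oracle calls with distance parameter at most $O(D\log^3 n)$. In the randomized version, 1, 2 and the bounds on steps and parameters hold for every outcome of the random bits. All hidden constants depend only on $c$. -/

import Mathlib

open scoped NNReal ENNReal

noncomputable section

namespace LowDiam

/-! ## Weighted graphs -/

/-- A weighted graph with nonnegative edge lengths whose nodes carry distinct identifiers. -/
structure Network (V : Type) where
  graph : SimpleGraph V
  len : Sym2 V → ℝ≥0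
  ident : V ↪ ℕ

variable {V : Type}

/-- The distance from `u` to `v` in `H`, with edge lengths `len`: the least length of a walk,
`⊤` if there is no walk. -/
def wdist (H : SimpleGraph V) (len : Sym2 V → ℝ≥0) (u v : V) : ℝ≥0∞ :=
  ⨅ p : H.Walk u v, (((p.edges.map len).sum : ℝ≥0) : ℝ≥0∞)

/-- The distance from the set `S` of sources to `v` in `H`, where the source `q` has delay
`del q`. -/
def delDist (H : SimpleGraph V) (len : Sym2 V → ℝ≥0) (S : Set V) (del : V → ℝ≥0) (v : V) :
    ℝ≥0∞ :=
  ⨅ q ∈ S, ((del q : ℝ≥0∞) + wdist H len q v)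

/-- The closed ball of radius `r` around `v`. -/
def Network.ball (N : Network V) (v : V) (r : ℝ≥0) : Set V :=
  {u | wdist N.graph N.len v u ≤ r}

/-- The diameter of the induced subgraph on `C`, distances being measured inside it. -/
def Network.clusterDiam (N : Network V) (C : Set V) : ℝ≥0∞ :=
  ⨆ u ∈ C, ⨆ v ∈ C,
    wdist ((⊤ : N.graph.Subgraph).induce C).spanningCoe N.len u v

/-! ## Rooted forests, given by parent pointers -/

/-- `f v = none`: `v` is not in the forest; `f v = some none`: `v` is a root;
`f v = some (some p)`: `v` has the parent `p`. -/
abbrev Pointers (V : Type) := V → Option (Option V)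

/-- Following the pointers from `v` leads to the root `q`, over a path of total length `d`. -/
inductive RootPath (f : Pointers V) (len : Sym2 V → ℝ≥0) : V → V → ℝ≥0 → Prop
  | root (v : V) : f v = some none → RootPath f len v v 0
  | step (v p q : V) (d : ℝ≥0) : f v = some (some p) → RootPath f len p q d →
      RootPath f len v q (len s(v, p) + d)

/-- `f` is a rooted forest, and a subgraph of `H`. -/
structure IsForest (f : Pointers V) (len : Sym2 V → ℝ≥0) {G : SimpleGraph V}
    (H : G.Subgraph) : Prop where
  verts_sub : ∀ v, f v ≠ none → v ∈ H.verts
  parent_adj : ∀ v p, f v = some (some p) → H.Adj v p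
  rooted : ∀ v, f v ≠ none → ∃ q d, RootPath f len v q d

/-- `u` is an ancestor of `v`; every node is its own ancestor. -/
def IsAncestor (f : Pointers V) (u v : V) : Prop :=
  Relation.ReflTransGen (fun a b => f a = some (some b)) v u

/-! ## The approximate distance oracle -/

/-- The requirements on the answer `f` to a call of the distance oracle with precision
parameter `ε` and distance parameter `R` on the subgraph `H`, the sources `S` and delays `del`. -/
structure IsApproxForest (N : Network V) (ε R : ℝ≥0) (H : N.graph.Subgraph) (S : Set V)
    (del : V → ℝ≥0) (f : Pointers V) : Prop where
  forest : IsForest f N.len H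
  approx : ∀ v q d, RootPath f N.len v q d →
    q ∈ S ∧ ((del q : ℝ≥0∞) + d ≤ (1 + ε) * delDist H.spanningCoe N.len S del v)
  covers : ∀ v ∈ H.verts, delDist H.spanningCoe N.len S del v ≤ R → f v ≠ none

/-- A (not necessarily consistent) oracle: its answer may also depend on the time of the call. -/
abbrev Oracle (N : Network V) :=
  ℕ → (ε R : ℝ≥0) → (H : N.graph.Subgraph) → (S : Set V) → (del : V → ℝ≥0) → Pointers V

def IsDistOracle (N : Network V) (O : Oracle N) : Prop :=
  ∀ (t : ℕ) (ε R : ℝ≥0) (H : N.graph.Subgraph) (S : Set V) (del : V → ℝ≥0), S ⊆ H.verts →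
    IsApproxForest N ε R H S del (O t ε R H S del)

/-! ## Distributed algorithms with oracles

All nodes run in lock-step. In one step the network performs either one round of message
exchange between neighbours or one oracle call. Local computation is free. -/

/-- What one step of the network does. -/
inductive Op
  | halt
  /-- every node sends one message to each neighbour -/
  | exchange
  /-- the approximate distance oracle with precision `ε` and distance parameter `R` -/
  | dist (ε R : ℝ≥0)
  /-- ancestor sums and descendant sums in a rooted forest of depth at most `R` -/
  | forestAgg (R : ℝ≥0)
  /-- the sum of one value per node, over all nodes -/
  | globalAgg

/-- What a node knows initially: the number of nodes, the parameter `D`, its own identifier, and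
for every number whether it is the identifier of a neighbour, and if so the length of the
connecting edge. -/
structure LocalInput where
  n : ℕ
  D : ℝ≥0
  ident : ℕ
  nbr : ℕ → Option ℝ≥0

/-- A node's part of the input to the distance oracle: whether it belongs to `H`, which edges to
neighbours it keeps, whether it is a source, and its delay. -/
structure DistInput where
  active : Prop
  keep : ℕ → Prop
  source : Prop
  delay : ℝ≥0

/-- What a node receives in one step. -/
inductive Reply
  /-- the message of each neighbour, by identifier -/
  | messages (m : ℕ → Option ℕ)
  /-- its position in the forest: not contained, root, or the identifier of its parent -/
  | tree (parent : Option (Option ℕ))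
  | sums (ancestors descendants : ℕ)
  | total (s : ℕ)

/-- A distributed algorithm in which each node has an additional private input of type `X n` on
networks with `n` nodes. Every node is in a local state; the operation to be
performed next is decided by a public state which initially depends only on `n` and `D` and is
then updated only by the results of global aggregations. -/
structure Alg (X : ℕ → Type) where
  Pub : Type
  State : Type
  pubInit : (n : ℕ) → (D : ℝ≥0) → Pub
  pubNext : Pub → ℕ → Pub
  op : Pub → Op
  init : (i : LocalInput) → X i.n → State
  /-- the message to the neighbour with the given identifier -/
  send : Pub → State → ℕ → ℕ
  distInput : Pub → State → DistInput
  /-- the position of the node in the forest to be aggregated over -/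
  forestInput : Pub → State → Option (Option ℕ)
  /-- the value of the node to be aggregated -/
  value : Pub → State → ℕ
  next : Pub → State → Reply → State
  /-- the output: the name of the cluster of the node -/
  label : State → ℕ
  /-- the output: whether the node is good -/
  isGood : State → Prop

/-- The state of all nodes and the public state. -/
structure Config {X : ℕ → Type} (A : Alg X) (V : Type) where
  pub : A.Pub
  loc : V → A.State

section Run

variable [Fintype V] (N : Network V)

open Classical in
def localInput (D : ℝ≥0) (v : V) : LocalInput where
  n := Fintype.card V
  D := D
  ident := N.ident v
  nbr := fun i => (Function.partialInv N.ident i).bind fun u =>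
    if N.graph.Adj v u then some (N.len s(v, u)) else none

open Classical in
/-- The messages that `v` receives when `a` sends `msg a i` to the neighbour with identifier `i`. -/
def inbox (msg : V → ℕ → ℕ) (v : V) : ℕ → Option ℕ :=
  fun i => (Function.partialInv N.ident i).bind fun u =>
    if N.graph.Adj v u then some (msg u (N.ident v)) else none

/-- The subgraph described by the nodes: an edge belongs to it if both endpoints do and both keep
it. -/
def inputSubgraph (q : V → DistInput) : N.graph.Subgraph where
  verts := {v | (q v).active}
  Adj u v := N.graph.Adj u v ∧ (q u).active ∧ (q v).active ∧
    (q u).keep (N.ident v) ∧ (q v).keep (N.ident u)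
  adj_sub h := h.1
  edge_vert h := h.2.1
  symm := ⟨fun _ _ h => ⟨h.1.symm, h.2.2.1, h.2.1, h.2.2.2.2, h.2.2.2.1⟩⟩

def inputSources (q : V → DistInput) : Set V := {v | (q v).active ∧ (q v).source}

/-- The parent pointers described by the nodes in terms of identifiers. -/
def inputPointers (p : V → Option (Option ℕ)) : Pointers V :=
  fun v => (p v).bind fun
    | none => some none
    | some i => (Function.partialInv N.ident i).map some

open Classical in
def ancestorSum (f : Pointers V) (x : V → ℕ) (v : V) : ℕ :=
  ∑ u with IsAncestor f u v, x u

open Classical in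
def descendantSum (f : Pointers V) (x : V → ℕ) (v : V) : ℕ :=
  ∑ u with IsAncestor f v u, x u

variable {X : ℕ → Type} (A : Alg X)

def initConfig (D : ℝ≥0) (x : V → X (Fintype.card V)) : Config A V where
  pub := A.pubInit (Fintype.card V) D
  loc := fun v => A.init (localInput N D v) (x v)

/-- The step at time `t`. -/
def stepConfig (O : Oracle N) (t : ℕ) (c : Config A V) : Config A V :=
  match A.op c.pub with
  | .halt => c
  | .exchange =>
    { pub := A.pubNext c.pub 0
      loc := fun v => A.next c.pub (c.loc v)
        (.messages (inbox N (fun u => A.send c.pub (c.loc u)) v)) }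
  | .dist ε R =>
    let q : V → DistInput := fun v => A.distInput c.pub (c.loc v)
    let f := O t ε R (inputSubgraph N q) (inputSources q) (fun v => (q v).delay)
    { pub := A.pubNext c.pub 0
      loc := fun v => A.next c.pub (c.loc v) (.tree ((f v).map (Option.map N.ident))) }
  | .forestAgg _ =>
    let f := inputPointers N (fun v => A.forestInput c.pub (c.loc v))
    let x : V → ℕ := fun v => A.value c.pub (c.loc v)
    { pub := A.pubNext c.pub 0
      loc := fun v => A.next c.pub (c.loc v) (.sums (ancestorSum f x v) (descendantSum f x v)) }
  | .globalAgg =>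
    let s := ∑ v, A.value c.pub (c.loc v)
    { pub := A.pubNext c.pub s
      loc := fun v => A.next c.pub (c.loc v) (.total s) }

/-- The configuration after `t` steps. -/
def run (O : Oracle N) (D : ℝ≥0) (x : V → X (Fintype.card V)) : ℕ → Config A V
  | 0 => initConfig N A D x
  | t + 1 => stepConfig N A O t (run O D x t)

/-- The step performed in configuration `c` obeys the rules: messages and aggregated values are
at most `M`, oracle calls have precision parameter `ε₀` and distance parameter at most `R₀`,
and forest aggregation is called on rooted forests of depth at most its distance parameter. -/
def LegalStep (M : ℕ) (ε₀ R₀ : ℝ) (c : Config A V) : Prop :=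
  match A.op c.pub with
  | .halt => True
  | .exchange => ∀ u v, N.graph.Adj u v → A.send c.pub (c.loc u) (N.ident v) ≤ M
  | .dist ε R => (ε : ℝ) = ε₀ ∧ (R : ℝ) ≤ R₀
  | .forestAgg R => (R : ℝ) ≤ R₀ ∧
    (let f := inputPointers N (fun v => A.forestInput c.pub (c.loc v))
     IsForest f N.len (⊤ : N.graph.Subgraph) ∧ ∀ v q d, RootPath f N.len v q d → d ≤ R) ∧
    ∀ v, A.value c.pub (c.loc v) ≤ M
  | .globalAgg => ∀ v, A.value c.pub (c.loc v) ≤ M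

/-- The run halts within `T` steps, all of which are legal. -/
def RunsWithin (O : Oracle N) (D : ℝ≥0) (x : V → X (Fintype.card V)) (T M : ℕ) (ε₀ R₀ : ℝ) :
    Prop :=
  A.op (run N A O D x T).pub = .halt ∧ ∀ t < T, LegalStep N A M ε₀ R₀ (run N A O D x t)

/-- The output partition after `T` steps: two nodes share a cluster iff they have equal labels. -/
def outClusters (O : Oracle N) (D : ℝ≥0) (x : V → X (Fintype.card V)) (T : ℕ) : Set (Set V) :=
  (Setoid.ker fun v => A.label ((run N A O D x T).loc v)).classes

/-- The output set of good nodes after `T` steps. -/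
def outGood (O : Oracle N) (D : ℝ≥0) (x : V → X (Fintype.card V)) (T : ℕ) : Set V :=
  {v | A.isGood ((run N A O D x T).loc v)}

/-- The base-2 logarithm of the number of nodes. -/
def logCard (V : Type) [Fintype V] : ℝ := Real.logb 2 (Fintype.card V)

/-- The time limit `⌊K log³ n⌋`. -/
def timeLimit (V : Type) [Fintype V] (K : ℕ) : ℕ := ⌊(K : ℝ) * logCard V ^ 3⌋₊

/-- On the given input the algorithm halts within `K log³ n` steps, with messages and aggregated
values at most `n ^ K`, precision parameter `1 / log² n` and distance parameters at most
`K log³ n * D`, and it outputs a partition with cluster diameter at most `K D log³ n` such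
that the `D`-ball of each good node lies inside a cluster. -/
def ComputesPadded (O : Oracle N) (D : ℝ≥0) (x : V → X (Fintype.card V)) (K : ℕ) : Prop :=
  RunsWithin N A O D x (timeLimit V K) (Fintype.card V ^ K) (1 / logCard V ^ 2)
      (K * logCard V ^ 3 * D) ∧
  (∀ C ∈ outClusters N A O D x (timeLimit V K),
    N.clusterDiam C ≤ ENNReal.ofReal (K * (D * logCard V ^ 3))) ∧
  ∀ v ∈ outGood N A O D x (timeLimit V K),
    ∃ C ∈ outClusters N A O D x (timeLimit V K), N.ball v D ⊆ C

/-- The output set of bad nodes: the complement of the good nodes. -/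
def outBad (O : Oracle N) (D : ℝ≥0) (x : V → X (Fintype.card V)) (K : ℕ) : Set V :=
  (outGood N A O D x (timeLimit V K))ᶜ

end Run

end LowDiam

end

noncomputable section

namespace LowDiam

variable {V : Type}

/-! ## Walks of bounded length -/

/-! Both algorithms give the sources delays and let every node join an approximately nearest source.
Trees of depth at most `R` give clusters of diameter at most `2 * R`; one more oracle call flags the
nodes near a border (`Machine.achieves_clusterProg`). An unflagged node has its `D`-ball inside its
cluster, and a flagged one has a node of another cluster within `12 D`. It remains to bound the
weight or the probability of the flagged nodes.

Deterministic case: all nodes start as terminals, and identifiers have `p` digits in base `s = 2 ^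
k`. A round treats one digit position and one digit value: terminals with that value ("red") get
delay 0, the others ("blue") a multiple of `50 D`. Edges between nodes with red and blue roots are
cut, and the roots become the terminals. Raising the delay by one unit makes the red region swallow
its `12 D`-neighbourhood (`Plan.Invariant.sweep_mono`), so ball growing (`Plan.exists_acceptable`)
finds a cut whose vicinity weighs at most `1 / (20 p)` of the red region plus `1 / (20 p s)` of
everything. A node is red at most once per digit position, so `p * s` rounds lose at most a tenth of
the weight. Up to factors `1 + ε`, the distance to the terminals grows only in red rounds
(`Plan.Invariant.succ`). In the end all terminals of a component have the same identifier.

The error of one comparison is of order `ε * p * (p * k * D)`. With `ε = 1 / log² n` and `p` of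
order `log n / k` this is of order `D / k`, so a large constant `k` makes it harmless. Bounded `n`
is handled by delays exponential in the identifier.

Randomized case: every node gets a head start of `50 D` times a truncated geometric variable. By
memorylessness the best source at `v` is rarely ahead by less than one unit (`card_not_hasLeader`),
and otherwise all nodes within `12 D` of `v` join it (`Clustered.flag_eq_zero_of_hasLeader`). -/

/-- There is a walk of length `d` from `a` in the relation `E`. -/
inductive Reach (E : V → V → Prop) (len : Sym2 V → ℝ≥0) (a : V) : V → ℝ≥0 → Prop
  | refl : Reach E len a a 0
  | tail {b c : V} {d : ℝ≥0} : Reach E len a b d → E b c → Reach E len a c (d + len s(b, c))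

namespace Reach

variable {E E' : V → V → Prop} {len : Sym2 V → ℝ≥0} {a b c : V} {d e : ℝ≥0}

theorem mono (h : Reach E len a b d) (hE : ∀ u v, E u v → E' u v) : Reach E' len a b d := by
  induction h with
  | refl => exact .refl
  | tail _ hbc ih => exact .tail ih (hE _ _ hbc)

theorem trans (h : Reach E len a b d) (h' : Reach E len b c e) : Reach E len a c (d + e) := by
  induction h' with
  | refl => simpa using h
  | tail _ hbc ih => rw [← add_assoc]; exact .tail ih hbc

theorem single (h : E a b) : Reach E len a b (len s(a, b)) := by
  simpa using Reach.tail (len := len) .refl h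

theorem symm (hE : ∀ u v, E u v → E v u) (h : Reach E len a b d) : Reach E len b a d := by
  induction h with
  | refl => exact .refl
  | @tail b c d _ hbc ih =>
    rw [add_comm, Sym2.eq_swap]
    exact (single (hE _ _ hbc)).trans ih

theorem invariant {α : Type*} {φ : V → α} (hφ : ∀ u v, E u v → φ u = φ v)
    (h : Reach E len a b d) : φ a = φ b := by
  induction h with
  | refl => rfl
  | tail _ hbc ih => exact ih.trans (hφ _ _ hbc)

theorem of_walk {H : SimpleGraph V} (p : H.Walk a b) :
    Reach H.Adj len a b (p.edges.map len).sum := by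
  induction p with
  | nil => exact .refl
  | cons h p ih =>
    simpa using (single h).trans ih

theorem exists_walk {H : SimpleGraph V} (h : Reach H.Adj len a b d) :
    ∃ p : H.Walk a b, (p.edges.map len).sum = d := by
  induction h with
  | refl => exact ⟨.nil, by simp⟩
  | tail _ hbc ih =>
    obtain ⟨p, hp⟩ := ih
    exact ⟨p.concat hbc, by simp [SimpleGraph.Walk.edges_concat, hp]⟩

theorem wdist_le {H : SimpleGraph V} (h : Reach H.Adj len a b d) : wdist H len a b ≤ d := by
  obtain ⟨p, hp⟩ := h.exists_walk
  exact (iInf_le _ p).trans (by rw [hp])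

end Reach

theorem exists_reach_of_wdist_lt {H : SimpleGraph V} {len : Sym2 V → ℝ≥0} {a b : V} {x : ℝ≥0}
    (h : wdist H len a b < x) : ∃ d < x, Reach H.Adj len a b d := by
  obtain ⟨p, hp⟩ := iInf_lt_iff.1 h
  exact ⟨_, by exact_mod_cast hp, Reach.of_walk p⟩

/-! ## Rooted forests -/

section Forest

variable {f : Pointers V} {len : Sym2 V → ℝ≥0} {E : V → V → Prop} {v q q' : V} {d d' : ℝ≥0}

theorem RootPath.unique (h : RootPath f len v q d) (h' : RootPath f len v q' d') :
    q' = q ∧ d' = d := by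
  induction h generalizing q' d' with
  | root v hv =>
    cases h' with
    | root => exact ⟨rfl, rfl⟩
    | step _ _ _ _ h => simp [hv] at h
  | step v p q d hv _ ih =>
    cases h' with
    | root _ h => simp [hv] at h
    | step _ p' _ d'' h hp =>
      have : p' = p := by simpa [hv] using h.symm
      subst this
      obtain ⟨rfl, rfl⟩ := ih hp
      exact ⟨rfl, rfl⟩

theorem RootPath.isRoot (h : RootPath f len v q d) : f q = some none := by
  induction h with
  | root v hv => exact hv
  | step _ _ _ _ _ _ ih => exact ih

theorem RootPath.isAncestor (h : RootPath f len v q d) : IsAncestor f q v := by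
  induction h with
  | root v hv => exact .refl
  | step _ _ _ _ hv _ ih => exact .head hv ih

theorem RootPath.eq_of_isAncestor (h : RootPath f len v q d) {u : V} (hu : IsAncestor f u v)
    (hr : f u = some none) : u = q := by
  induction h with
  | root v hv =>
    rcases Relation.ReflTransGen.cases_head hu with h | ⟨c, hc, -⟩
    · exact h.symm
    · simp [hv] at hc
  | step v p q d hv _ ih =>
    rcases Relation.ReflTransGen.cases_head hu with rfl | ⟨c, hc, hcu⟩
    · simp [hv] at hr
    · have : p = c := by simpa [hv] using hc
      subst this
      exact ih hcu

theorem RootPath.reach (hE : ∀ v p, f v = some (some p) → E v p)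
    (h : RootPath f len v q d) : Reach E len v q d := by
  induction h with
  | root v hv => exact .refl
  | step v p q d hv _ ih => exact (Reach.single (hE _ _ hv)).trans ih

/-- Forest edges join nodes with the same root, so a root path survives the cutting of edges
according to any function of the root. -/
theorem RootPath.reach_of_root_invariant
    (hE : ∀ v p, f v = some (some p) → (∀ q d d', RootPath f len v q d → RootPath f len p q d' →
      E v p)) (h : RootPath f len v q d) : Reach E len v q d := by
  induction h with
  | root v hv => exact .refl
  | step v p q d hv hp ih =>
    exact (Reach.single (hE _ _ hv _ _ _ (.step _ _ _ _ hv hp) hp)).trans ih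

/-- A node has only one root among its ancestors, so summing values that vanish off the roots
broadcasts the value of the root down its tree. -/
theorem ancestorSum_eq [Fintype V] {x : V → ℕ} (hx : ∀ u, f u ≠ some none → x u = 0)
    (h : RootPath f len v q d) : ancestorSum f x v = x q := by
  classical
  unfold ancestorSum
  rw [Finset.sum_eq_single q]
  · intro u hu huq
    refine hx u fun hr => huq (h.eq_of_isAncestor ?_ hr)
    simpa using hu
  · intro hq
    exact absurd h.isAncestor (by simpa using hq)

end Forest

/-- The guarantees of the distance oracle, in terms of walks. -/
structure Answers (E : V → V → Prop) (len : Sym2 V → ℝ≥0) (Q : Set V) (del : V → ℝ≥0)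
    (ε R : ℝ≥0) (f : Pointers V) : Prop where
  parent : ∀ v p, f v = some (some p) → E v p
  covers : ∀ v, ∀ q ∈ Q, ∀ d, Reach E len q v d → del q + d ≤ R → ∃ q' d', RootPath f len v q' d'
  source : ∀ v q d, RootPath f len v q d → q ∈ Q
  approx : ∀ v q' d', RootPath f len v q' d' → ∀ q ∈ Q, ∀ d, Reach E len q v d →
    del q' + d' ≤ (1 + ε) * (del q + d)

theorem IsApproxForest.answers {N : Network V} {ε R : ℝ≥0} {H : N.graph.Subgraph} {S : Set V}
    {del : V → ℝ≥0} {f : Pointers V} (h : IsApproxForest N ε R H S del f)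
    (hH : ∀ v, v ∈ H.verts) : Answers H.Adj N.len S del ε R f where
  parent := h.forest.parent_adj
  covers v q hq d hd hR := by
    refine h.forest.rooted v (h.covers v (hH v) ?_)
    refine (iInf₂_le q hq).trans ?_
    have : wdist H.spanningCoe N.len q v ≤ d := Reach.wdist_le (hd.mono (by simp))
    calc (del q : ℝ≥0∞) + wdist H.spanningCoe N.len q v ≤ del q + d := by gcongr
      _ ≤ R := by exact_mod_cast hR
  source v q d hp := (h.approx v q d hp).1
  approx v q' d' hp q hq d hd := by
    have h1 := (h.approx v q' d' hp).2
    have : wdist H.spanningCoe N.len q v ≤ d := Reach.wdist_le (hd.mono (by simp))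
    have h2 : delDist H.spanningCoe N.len S del v ≤ del q + d :=
      (iInf₂_le q hq).trans (by gcongr)
    have h3 : (del q' : ℝ≥0∞) + d' ≤ (1 + ε) * (del q + d) := h1.trans (by gcongr)
    exact_mod_cast h3

/-! ## Straight-line distributed programs -/

/-- The part of the state of a node that only changes in message rounds. -/
structure Core where
  inp : LocalInput
  weight : ℕ
  delay : ℝ≥0
  keep : ℕ → Prop
  terminal : Prop
  hist : List ℕ

/-- The state of a node. -/
structure NodeState where
  core : Core
  tree : Option (Option ℕ)
  flag : ℕ

/-- The instructions of a straight-line program. -/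
inductive Instr
  /-- a call of the distance oracle on the kept edges, with the given sources and delays -/
  | dist (src : Core → Prop) (del : (ℕ → ℕ) → Core → ℝ≥0)
  /-- every node of the last forest learns the value of its root -/
  | agg (val : Core → ℕ)
  /-- edges between nodes with different flags are cut -/
  | cut
  /-- the total weight of the nodes with nonzero flag is stored in a register -/
  | sum (k : ℕ)

/-- The public state: the parameters of the oracle calls, the remaining program, the registers. -/
structure Control where
  eps : ℝ≥0
  rad : ℝ≥0
  prog : List Instr
  reg : ℕ → ℕ

/-- The precision parameter `1 / log² n`. -/
def precision (n : ℕ) : ℝ≥0 := Real.toNNReal (1 / Real.logb 2 n ^ 2)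

theorem coe_precision (n : ℕ) : (precision n : ℝ) = 1 / Real.logb 2 n ^ 2 :=
  Real.coe_toNNReal _ (by positivity)

/-- Cut edges never return, so an edge stays kept exactly while its ends share the whole history;
`Represents.keep` records this. -/
def NodeState.receive (st : NodeState) : Reply → NodeState
  | .messages m =>
    { st with
      core := { st.core with
        keep := fun i => st.core.keep i ∧ m i = some st.flag
        terminal := st.tree = some none
        hist := st.flag :: st.core.hist } }
  | .tree p => { st with tree := p }
  | .sums a _ => { st with flag := a }
  | .total _ => st

/-- What determines a distributed algorithm: a program, the distance parameter, and the weights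
and delays computed from the private inputs. -/
structure Machine (X : ℕ → Type) where
  prog : ℕ → List Instr
  rad : ℕ → ℝ≥0 → ℝ≥0
  weight : ∀ n, X n → ℕ
  delay : ∀ i : LocalInput, X i.n → ℝ≥0

def Machine.alg {X : ℕ → Type} (m : Machine X) : Alg X where
  Pub := Control
  State := NodeState
  pubInit n D := ⟨precision n, m.rad n D, m.prog n, 0⟩
  pubNext p s := match p.prog with
    | .sum k :: l => { p with prog := l, reg := Function.update p.reg k s }
    | l => { p with prog := l.tail }
  op p := match p.prog with
    | [] => .halt
    | .dist _ _ :: _ => .dist p.eps p.rad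
    | .agg _ :: _ => .forestAgg p.rad
    | .cut :: _ => .exchange
    | .sum _ :: _ => .globalAgg
  init i x :=
    { core :=
        { inp := i
          weight := m.weight i.n x
          delay := m.delay i x
          -- Longer edges lie on no walk of length at most `12 D`; without them a component has
          -- diameter at most `12 n D`.
          keep := fun j => ∃ l, i.nbr j = some l ∧ l ≤ 12 * i.D
          terminal := True
          hist := [] }
      tree := none
      -- Nonzero, so that a global sum as the first instruction yields the total weight.
      flag := 1 }
  send _ st _ := st.flag
  distInput p st := match p.prog with
    | .dist src del :: _ => ⟨True, st.core.keep, src st.core, del p.reg st.core⟩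
    | _ => ⟨True, st.core.keep, False, 0⟩
  forestInput _ st := st.tree
  value p st := match p.prog with
    | .agg val :: _ => if st.tree = some none then val st.core else 0
    | _ => if st.flag = 0 then 0 else st.core.weight
  next _ st r := st.receive r
  -- The last cut of every program is made with the identifier of the root as flag.
  label st := st.core.hist.headD 0
  isGood st := st.flag = 0

/-- The kept edges, when edges of length more than `12 D` and edges between nodes of different
history have been cut. -/
def Network.link (N : Network V) (D : ℝ≥0) (h : V → List ℕ) (u v : V) : Prop :=
  N.graph.Adj u v ∧ N.len s(u, v) ≤ 12 * D ∧ h u = h v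

theorem Network.link_symm (N : Network V) (D : ℝ≥0) (h : V → List ℕ) (u v : V)
    (huv : N.link D h u v) : N.link D h v u :=
  ⟨huv.1.symm, by rw [Sym2.eq_swap]; exact huv.2.1, huv.2.2.symm⟩

theorem inbox_adj (N : Network V) {msg : V → ℕ → ℕ} {u v : V} (h : N.graph.Adj u v) :
    inbox N msg u (N.ident v) = some (msg v (N.ident u)) := by
  simp [inbox, Function.partialInv_left N.ident.injective, h]

/-- The tree pointers of the nodes describe the forest `f`. -/
def PointsTo (N : Network V) (f : Pointers V) (S : V → NodeState) : Prop :=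
  ∀ v, (S v).tree = (f v).map (Option.map N.ident)

theorem inputPointers_eq {N : Network V} {S : V → NodeState} {f : Pointers V}
    (hf : PointsTo N f S) :
    inputPointers N (fun v => (S v).tree) = f := by
  funext v
  simp only [inputPointers, hf v]
  rcases f v with _ | _ | p
  · rfl
  · rfl
  · simp [Function.partialInv_left N.ident.injective]

/-! ### Execution of programs -/

section Run

variable [Fintype V] (N : Network V)

theorem localInput_nbr {D : ℝ≥0} {u v : V} (h : N.graph.Adj u v) :
    (localInput N D u).nbr (N.ident v) = some (N.len s(u, v)) := by
  simp [localInput, Function.partialInv_left N.ident.injective, h, -ENNReal.some_eq_coe]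

theorem exists_of_localInput_nbr {D l : ℝ≥0} {u : V} {i : ℕ}
    (h : (localInput N D u).nbr i = some l) :
    ∃ v, N.graph.Adj u v ∧ N.ident v = i ∧ N.len s(u, v) = l := by
  simp only [localInput, Option.bind_eq_some_iff] at h
  obtain ⟨v, hv, h⟩ := h
  rw [N.ident.injective.isPartialInv] at hv
  split_ifs at h with hadj
  exact ⟨v, hadj, hv, Option.some.inj h⟩

/-- The configuration `k` steps after the configuration `c` at time `t`. -/
def runFrom {X : ℕ → Type} (A : Alg X) (O : Oracle N) (t : ℕ) (c : Config A V) : ℕ → Config A V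
  | 0 => c
  | k + 1 => stepConfig N A O (t + k) (runFrom A O t c k)

variable {X : ℕ → Type}

theorem run_eq_runFrom (A : Alg X) (O : Oracle N) (D : ℝ≥0) (x : V → X (Fintype.card V)) (k : ℕ) :
    run N A O D x k = runFrom N A O 0 (initConfig N A D x) k := by
  induction k with
  | zero => rfl
  | succ k ih => simp [run, runFrom, ih]

theorem runFrom_add (A : Alg X) (O : Oracle N) (t : ℕ) (c : Config A V) (j k : ℕ) :
    runFrom N A O t c (j + k) = runFrom N A O (t + j) (runFrom N A O t c j) k := by
  induction k with
  | zero => rfl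
  | succ k ih => rw [← add_assoc, runFrom, runFrom, ih, add_assoc]

theorem runFrom_halt (A : Alg X) (O : Oracle N) (t : ℕ) (c : Config A V) (hc : A.op c.pub = .halt)
    (k : ℕ) : runFrom N A O t c k = c := by
  induction k with
  | zero => rfl
  | succ k ih => rw [runFrom, ih, stepConfig, hc]

/-- The state of the nodes is described by a history and a set of terminals. -/
structure Represents (D : ℝ≥0) (μ : V → ℕ) (δ : V → ℝ≥0) (h : V → List ℕ) (Q : Set V)
    (S : V → NodeState) : Prop where
  inp : ∀ v, (S v).core.inp = localInput N D v
  weight : ∀ v, (S v).core.weight = μ v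
  delay : ∀ v, (S v).core.delay = δ v
  terminal : ∀ v, (S v).core.terminal ↔ v ∈ Q
  hist : ∀ v, (S v).core.hist = h v
  keep : ∀ u v, N.graph.Adj u v →
    ((S u).core.keep (N.ident v) ↔ N.len s(u, v) ≤ 12 * D ∧ h u = h v)

variable {N}

theorem Represents.of_core_eq {D : ℝ≥0} {μ : V → ℕ} {δ : V → ℝ≥0} {h : V → List ℕ} {Q : Set V}
    {S S' : V → NodeState} (hS : Represents N D μ δ h Q S) (hc : ∀ v, (S' v).core = (S v).core) :
    Represents N D μ δ h Q S' := by
  constructor <;> intros <;> simp only [hc]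
  exacts [hS.inp _, hS.weight _, hS.delay _, hS.terminal _, hS.hist _, hS.keep _ _ ‹_›]

variable (N) in
/-- From the given state, the program `l` leads to a state with the property `Post`, by legal
steps. -/
def Machine.Achieves (m : Machine X) (O : Oracle N) (M : ℕ) (ε R : ℝ≥0) (l : List Instr)
    (reg : ℕ → ℕ) (S : V → NodeState) (Post : (ℕ → ℕ) → (V → NodeState) → Prop) : Prop :=
  ∀ (t : ℕ) (l' : List Instr), ∃ reg' S', Post reg' S' ∧
    runFrom N m.alg O t ⟨⟨ε, R, l ++ l', reg⟩, S⟩ l.length = ⟨⟨ε, R, l', reg'⟩, S'⟩ ∧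
    ∀ k < l.length, LegalStep N m.alg M ε R (runFrom N m.alg O t ⟨⟨ε, R, l ++ l', reg⟩, S⟩ k)

section Achieves

variable {m : Machine X} {O : Oracle N} {M : ℕ} {ε R : ℝ≥0} {l₁ l₂ : List Instr}
  {reg : ℕ → ℕ} {S : V → NodeState} {Post Post' : (ℕ → ℕ) → (V → NodeState) → Prop}

theorem Machine.Achieves.nil (h : Post reg S) : m.Achieves N O M ε R [] reg S Post :=
  fun _ _ => ⟨reg, S, h, rfl, by simp⟩

/-- `Machine.Achieves` quantifies over the time and the remaining program, so the first half can run
with the second as its continuation. -/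
theorem Machine.Achieves.append
    (h₁ : m.Achieves N O M ε R l₁ reg S fun reg' S' => m.Achieves N O M ε R l₂ reg' S' Post) :
    m.Achieves N O M ε R (l₁ ++ l₂) reg S Post := by
  intro t l'
  obtain ⟨reg₁, S₁, h₂, e₁, g₁⟩ := h₁ t (l₂ ++ l')
  obtain ⟨reg₂, S₂, hP, e₂, g₂⟩ := h₂ (t + l₁.length) l'
  refine ⟨reg₂, S₂, hP, ?_, fun k hk => ?_⟩
  · rw [List.length_append, runFrom_add, List.append_assoc, e₁, e₂]
  · rw [List.append_assoc]
    rcases lt_or_ge k l₁.length with h | h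
    · exact g₁ k h
    · obtain ⟨j, rfl⟩ := Nat.exists_eq_add_of_le h
      rw [runFrom_add, e₁]
      exact g₂ j (by simpa using hk)

theorem Machine.Achieves.mono (h : m.Achieves N O M ε R l₁ reg S Post)
    (hP : ∀ reg S, Post reg S → Post' reg S) : m.Achieves N O M ε R l₁ reg S Post' := by
  intro t l'
  obtain ⟨reg₁, S₁, h, h'⟩ := h t l'
  exact ⟨reg₁, S₁, hP _ _ h, h'⟩

theorem Machine.Achieves.singleton {i : Instr}
    (h : ∀ t l', LegalStep N m.alg M ε R ⟨⟨ε, R, i :: l', reg⟩, S⟩ ∧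
      ∃ reg' S', Post reg' S' ∧
        stepConfig N m.alg O t ⟨⟨ε, R, i :: l', reg⟩, S⟩ = ⟨⟨ε, R, l', reg'⟩, S'⟩) :
    m.Achieves N O M ε R [i] reg S Post := by
  intro t l'
  obtain ⟨hl, reg', S', hP, e⟩ := h t l'
  refine ⟨reg', S', hP, e, fun k hk => ?_⟩
  obtain rfl : k = 0 := by simpa using hk
  exact hl

theorem Machine.Achieves.cons {i : Instr}
    (h₁ : m.Achieves N O M ε R [i] reg S fun reg' S' => m.Achieves N O M ε R l₂ reg' S' Post) :
    m.Achieves N O M ε R (i :: l₂) reg S Post :=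
  Machine.Achieves.append (l₁ := [i]) h₁

variable {D : ℝ≥0} {μ : V → ℕ} {δ : V → ℝ≥0} {h : V → List ℕ} {Q : Set V}

/-- Repeated calls may be answered differently, so the postcondition is required for every forest
satisfying `Answers`. -/
theorem Machine.achieves_dist (hO : IsDistOracle N O) (hS : Represents N D μ δ h Q S)
    {src : Core → Prop} {del : (ℕ → ℕ) → Core → ℝ≥0}
    (hP : ∀ f S', Answers (N.link D h) N.len {v | src (S v).core} (fun v => del reg (S v).core)
      ε R f → PointsTo N f S' → (∀ v, (S' v).core = (S v).core) → (∀ v, (S' v).flag = (S v).flag) →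
      Post reg S') :
    m.Achieves N O M ε R [.dist src del] reg S Post := by
  refine .singleton fun t l' => ⟨⟨rfl, le_rfl⟩, ?_⟩
  let q : V → DistInput := fun v => ⟨True, (S v).core.keep, src (S v).core, del reg (S v).core⟩
  let f := O t ε R (inputSubgraph N q) (inputSources q) fun v => (q v).delay
  have hf : Answers (inputSubgraph N q).Adj N.len (inputSources q) (fun v => (q v).delay) ε R f :=
    (hO t ε R (inputSubgraph N q) (inputSources q) (fun v => (q v).delay)
      fun v hv => hv.1).answers fun v => trivial
  have hE : (inputSubgraph N q).Adj = N.link D h := by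
    ext u v
    simp only [inputSubgraph, q, Network.link, true_and]
    constructor
    · rintro ⟨ha, hu, -⟩
      exact ⟨ha, (hS.keep u v ha).1 hu⟩
    · rintro ⟨ha, hu⟩
      refine ⟨ha, (hS.keep u v ha).2 hu, (hS.keep v u ha.symm).2 ?_⟩
      rw [Sym2.eq_swap]
      exact ⟨hu.1, hu.2.symm⟩
  have hsrc : inputSources q = {v | src (S v).core} := by
    ext v; simp [inputSources, q]
  rw [hE, hsrc] at hf
  exact ⟨reg, fun v => { S v with tree := (f v).map (Option.map N.ident) },
    hP f _ hf (fun v => rfl) (fun v => rfl) (fun v => rfl), rfl⟩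

theorem Machine.achieves_agg {f : Pointers V} (hf : PointsTo N f S)
    (hadj : ∀ v p, f v = some (some p) → N.graph.Adj v p)
    (hR : ∀ v, ∃ q d, RootPath f N.len v q d ∧ d ≤ R) {val : Core → ℕ}
    (hM : ∀ v, val (S v).core ≤ M)
    (hP : ∀ S', (∀ v q d, RootPath f N.len v q d → (S' v).flag = val (S q).core) →
      PointsTo N f S' → (∀ v, (S' v).core = (S v).core) → Post reg S') :
    m.Achieves N O M ε R [.agg val] reg S Post := by
  refine .singleton fun t l' => ⟨⟨le_rfl, ?_, fun v => ?_⟩, ?_⟩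
  · change IsForest (inputPointers N fun v => (S v).tree) _ _ ∧ ∀ v q d,
      RootPath (inputPointers N fun v => (S v).tree) _ _ _ _ → _
    rw [inputPointers_eq hf]
    refine ⟨⟨fun v _ => trivial, hadj, fun v _ => ?_⟩, fun v q d h => ?_⟩
    · obtain ⟨q, d, h, -⟩ := hR v
      exact ⟨q, d, h⟩
    · obtain ⟨q', d', h', hd⟩ := hR v
      obtain ⟨-, rfl⟩ := h'.unique h
      exact hd
  · change (if (S v).tree = some none then val (S v).core else 0) ≤ M
    split_ifs
    exacts [hM v, Nat.zero_le _]
  · let x : V → ℕ := fun v => if (S v).tree = some none then val (S v).core else 0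
    refine ⟨reg, fun v => { S v with
      flag := ancestorSum (inputPointers N fun v => (S v).tree) x v }, hP _ ?_ hf fun v => rfl, rfl⟩
    intro v q d h
    have hx : ∀ u, (S u).tree = some none ↔ f u = some none := by
      intro u
      rw [hf u]
      rcases f u with _ | _ | p <;> simp
    change ancestorSum _ x v = _
    rw [inputPointers_eq hf, ancestorSum_eq (fun u hu => if_neg (mt (hx u).1 hu)) h]
    exact if_pos ((hx q).2 h.isRoot)

theorem Machine.achieves_sum (hS : Represents N D μ δ h Q S) {k : ℕ} (hM : ∀ v, μ v ≤ M)
    (hP : Post (Function.update reg k (∑ v, if (S v).flag = 0 then 0 else μ v)) S) :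
    m.Achieves N O M ε R [.sum k] reg S Post := by
  refine .singleton fun t l' => ⟨fun v => ?_, _, S, hP, ?_⟩
  · change (if (S v).flag = 0 then 0 else (S v).core.weight) ≤ M
    rw [hS.weight]
    split_ifs
    exacts [Nat.zero_le _, hM v]
  · simp only [← hS.weight]
    rfl

theorem Machine.achieves_cut (hS : Represents N D μ δ h Q S) {f : Pointers V}
    (hf : PointsTo N f S) (hM : ∀ v, (S v).flag ≤ M)
    (hP : ∀ S', Represents N D μ δ (fun v => (S v).flag :: h v) {v | f v = some none} S' →
      Post reg S') :
    m.Achieves N O M ε R [.cut] reg S Post := by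
  refine .singleton fun t l' => ⟨fun u v _ => hM u, reg, fun v => (S v).receive
    (.messages (inbox N (fun u _ => (S u).flag) v)), hP _ ?_, rfl⟩
  refine ⟨hS.inp, hS.weight, hS.delay, fun v => ?_, fun v => ?_, fun u v huv => ?_⟩
  · change (S v).tree = some none ↔ f v = some none
    rw [hf v]
    rcases f v with _ | _ | p <;> simp
  · change (S v).flag :: (S v).core.hist = _
    rw [hS.hist]
  · change (S u).core.keep (N.ident v) ∧ inbox N _ u (N.ident v) = some (S u).flag ↔ _
    rw [hS.keep u v huv, inbox_adj N huv, List.cons.injEq, Option.some.injEq]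
    tauto

end Achieves

/-- The initial states. -/
theorem represents_init (m : Machine X) (D : ℝ≥0) (x : V → X (Fintype.card V)) :
    Represents N D (fun v => m.weight _ (x v)) (fun v => m.delay (localInput N D v) (x v))
      (fun _ => []) Set.univ (initConfig N m.alg D x).loc := by
  refine ⟨fun _ => rfl, fun _ => rfl, fun _ => rfl, fun v => ?_, fun _ => rfl, fun u v huv => ?_⟩
  · exact ⟨fun _ => trivial, fun _ => trivial⟩
  · change (∃ l, (localInput N D u).nbr (N.ident v) = some l ∧ l ≤ 12 * D) ↔ _
    simp [localInput_nbr N huv, -ENNReal.some_eq_coe]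

end Run

/-! ## Clusters from terminals with delays -/

/-- A short edge to a neighbour has been cut. -/
def Core.Boundary (c : Core) : Prop :=
  ∃ i l, c.inp.nbr i = some l ∧ l ≤ 2 * c.inp.D ∧ ¬ c.keep i

open Classical in
/-- Each node joins the cluster of a nearest terminal; afterwards the nodes close to the boundary
of their cluster get a nonzero flag. -/
def clusterProg : List Instr :=
  [.dist Core.terminal fun _ c => c.delay,
   .agg fun c => c.inp.ident,
   .cut,
   -- With approximation factor at most 2, a border node within `2 D` beats all delays `5 D`, as `2
   -- * 2 < 5`, while tree depth stays at most `10 D`.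
   .dist (fun _ => True) fun _ c => if c.Boundary then 0 else 5 * c.inp.D,
   .agg fun c => if c.Boundary then 1 else 0]

/-- The clusters are the trees of the forest `f`, and the flags are correct. -/
structure Clustered (N : Network V) (D R : ℝ≥0) (h : V → List ℕ) (f : Pointers V)
    (S : V → NodeState) : Prop where
  rooted : ∀ v, ∃ q d, RootPath f N.len v q d ∧ d ≤ R
  parent : ∀ v p, f v = some (some p) → N.link D h v p
  hist : ∀ v q d, RootPath f N.len v q d → (S v).core.hist = N.ident q :: h v
  good : ∀ v, (S v).flag = 0 → ∀ u d, Reach N.graph.Adj N.len v u d → d < 2 * D →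
    (S u).core.hist = (S v).core.hist
  bad : ∀ v, (S v).flag ≠ 0 → ∃ u d, Reach (N.link D fun _ => []) N.len v u d ∧ d ≤ 12 * D ∧
    (S u).core.hist ≠ (S v).core.hist

/-- Equal labels mean equal roots, and root paths stay inside the cluster because all their nodes
have the same root. -/
theorem Clustered.clusterDiam_le {N : Network V} {D R : ℝ≥0} {h : V → List ℕ} {f : Pointers V}
    {S : V → NodeState} (hC : Clustered N D R h f S) (C : Set V)
    (hCl : ∀ u ∈ C, ∀ v, v ∈ C ↔ (S v).core.hist.headD 0 = (S u).core.hist.headD 0) :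
    N.clusterDiam C ≤ ((2 * R : ℝ≥0) : ℝ≥0∞) := by
  refine iSup₂_le fun u hu => iSup₂_le fun v hv => ?_
  let H := ((⊤ : N.graph.Subgraph).induce C).spanningCoe
  have key : ∀ w ∈ C, ∀ q d, RootPath f N.len w q d → Reach H.Adj N.len w q d := by
    intro w hw q d hq
    have : ∀ x y, f x = some (some y) → (∀ q d d', RootPath f N.len x q d →
        RootPath f N.len y q d' → (x ∈ C ↔ y ∈ C)) := by
      intro x y _ q d d' hx hy
      have e : (S x).core.hist.headD 0 = (S y).core.hist.headD 0 := by
        rw [hC.hist x q d hx, hC.hist y q d' hy]; rfl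
      exact ⟨fun h => (hCl x h y).2 e.symm, fun h => (hCl y h x).2 e⟩
    induction hq with
    | root => exact .refl
    | step x y q d hxy hy ih =>
      have hyC := (this x y hxy q _ _ (.step x y q d hxy hy) hy).1 hw
      exact (Reach.single ⟨hw, hyC, (hC.parent x y hxy).1⟩).trans (ih hyC)
  obtain ⟨q, d, hq, hd⟩ := hC.rooted u
  obtain ⟨q', d', hq', hd'⟩ := hC.rooted v
  have e := (hCl u hu v).1 hv
  rw [hC.hist u q d hq, hC.hist v q' d' hq'] at e
  obtain rfl : q' = q := N.ident.injective e
  have hr := (key u hu q' d hq).trans ((key v hv q' d' hq').symm fun _ _ h => h.symm)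
  refine hr.wdist_le.trans ?_
  rw [two_mul]
  exact_mod_cast add_le_add hd hd'

section Run

variable [Fintype V] {N : Network V} {X : ℕ → Type}

theorem Represents.boundary_iff {D : ℝ≥0} {μ : V → ℕ} {δ : V → ℝ≥0} {h : V → List ℕ} {Q : Set V}
    {S : V → NodeState} (hS : Represents N D μ δ h Q S) (v : V) :
    (S v).core.Boundary ↔
      ∃ u, N.graph.Adj v u ∧ N.len s(v, u) ≤ 2 * D ∧ h u ≠ h v := by
  have h2 : 2 * D ≤ 12 * D := by gcongr; norm_num
  unfold Core.Boundary
  rw [hS.inp v]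
  constructor
  · rintro ⟨i, l, hi, hl, hk⟩
    obtain ⟨u, hu, rfl, rfl⟩ := exists_of_localInput_nbr N hi
    rw [hS.keep v u hu] at hk
    exact ⟨u, hu, hl, fun e => hk ⟨hl.trans h2, e.symm⟩⟩
  · rintro ⟨u, hu, hl, hne⟩
    exact ⟨N.ident u, _, localInput_nbr N hu, hl, by
      rw [hS.keep v u hu]; exact fun hk => hne hk.2.symm⟩

open Classical in
theorem Machine.achieves_clusterProg {m : Machine X} {O : Oracle N} {M : ℕ} {ε R D : ℝ≥0}
    {reg : ℕ → ℕ} {S : V → NodeState} {μ : V → ℕ} {δ : V → ℝ≥0} {h : V → List ℕ} {Q : Set V}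
    (hO : IsDistOracle N O) (hS : Represents N D μ δ h Q S) (hD : 0 < D) (hε : ε ≤ 1)
    (hR : 10 * D ≤ R) (hM : 1 ≤ M) (hid : ∀ v, N.ident v ≤ M)
    (hQ : ∀ v, ∃ q ∈ Q, ∃ d, Reach (N.link D h) N.len q v d ∧ 2 * (δ q + d) ≤ R) :
    m.Achieves N O M ε R clusterProg reg S fun _ S' =>
      ∃ f, Answers (N.link D h) N.len Q δ ε R f ∧ Clustered N D R h f S' := by
  have h1ε : 1 + ε ≤ 2 := by rw [← one_add_one_eq_two]; gcongr
  refine .cons (achieves_dist hO hS fun f S₁ hf ht₁ hc₁ _ => ?_)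
  have hS₁ := hS.of_core_eq hc₁
  have hsrc : {v | (S v).core.terminal} = Q := Set.ext hS.terminal
  simp only [hsrc, hS.delay] at hf
  -- The factor 2 in `hQ` pays for `1 + ε`, so `R` bounds the depth of the trees too, as forest
  -- aggregation demands.
  have hroot : ∀ v, ∃ q d, RootPath f N.len v q d ∧ d ≤ R := by
    intro v
    obtain ⟨q, hq, d, hd, hqd⟩ := hQ v
    obtain ⟨q', d', h'⟩ := hf.covers v q hq d hd
      (le_trans (le_mul_of_one_le_left zero_le one_le_two) hqd)
    refine ⟨q', d', h', ?_⟩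
    calc d' ≤ δ q' + d' := le_add_self
      _ ≤ (1 + ε) * (δ q + d) := hf.approx v q' d' h' q hq d hd
      _ ≤ 2 * (δ q + d) := by gcongr
      _ ≤ R := hqd
  refine .cons (achieves_agg ht₁ (fun v p hp => (hf.parent v p hp).1) hroot
    (fun v => by rw [hS₁.inp]; exact hid v) fun S₂ hfl₂ ht₂ hc₂ => ?_)
  have hS₂ := hS₁.of_core_eq hc₂
  simp only [hS₁.inp] at hfl₂
  have hflM : ∀ v, (S₂ v).flag ≤ M := by
    intro v
    obtain ⟨q, d, hq, -⟩ := hroot v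
    rw [hfl₂ v q d hq]
    exact hid q
  refine .cons (achieves_cut hS₂ ht₂ hflM fun S₃ hS₃ => ?_)
  set h₃ : V → List ℕ := fun v => (S₂ v).flag :: h v with hh₃
  refine .cons (achieves_dist hO hS₃ fun f₄ S₄ hf₄ ht₄ hc₄ _ => ?_)
  have hS₄ := hS₃.of_core_eq hc₄
  have hdel₄ : ∀ v, (if (S₃ v).core.Boundary then 0 else 5 * (S₃ v).core.inp.D) ≤ 5 * D := by
    intro v
    split_ifs
    · exact zero_le
    · rw [hS₃.inp]; rfl
  have hroot₄ : ∀ v, ∃ q d, RootPath f₄ N.len v q d ∧ d ≤ 10 * D := by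
    intro v
    obtain ⟨q', d', h'⟩ := hf₄.covers v v trivial 0 .refl
      (by rw [add_zero]; exact (hdel₄ v).trans (le_trans (by gcongr; norm_num) hR))
    refine ⟨q', d', h', ?_⟩
    calc d' ≤ _ + d' := le_add_self
      _ ≤ (1 + ε) * (_ + 0) := hf₄.approx v q' d' h' v trivial 0 .refl
      _ ≤ 2 * (5 * D + 0) := mul_le_mul' h1ε (add_le_add_left (hdel₄ v) 0)
      _ = 10 * D := by ring
  refine achieves_agg ht₄ (fun v p hp => (hf₄.parent v p hp).1)
    (fun v => (hroot₄ v).imp fun _ h => h.imp fun _ h => ⟨h.1, h.2.trans hR⟩)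
    (fun v => by split_ifs <;> omega) fun S₅ hfl₅ ht₅ hc₅ => ⟨f, hf, ?_⟩
  have hS₅ := hS₄.of_core_eq hc₅
  refine ⟨hroot, hf.parent, fun v q d hq => ?_, fun v hv => ?_, fun v hv => ?_⟩
  · rw [hS₅.hist]
    simp only [hh₃]
    rw [hfl₂ v q d hq]
    rfl
  · obtain ⟨q, d₀, hq, -⟩ := hroot₄ v
    have hqb : ¬ (S₃ q).core.Boundary := by
      rw [hfl₅ v q d₀ hq] at hv
      intro hb
      rw [hc₄, if_pos hb] at hv
      exact one_ne_zero hv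
    have key : ∀ u d, Reach N.graph.Adj N.len v u d → d < 2 * D →
        Reach (N.link D h₃) N.len v u d := by
      intro u d hr
      induction hr with
      | refl => exact fun _ => .refl
      | @tail b c d hvb hbc ih =>
        intro hlt
        have hd : d < 2 * D := lt_of_le_of_lt le_self_add hlt
        have hvb' := ih hd
        have hlen : N.len s(b, c) ≤ 2 * D := le_add_self.trans hlt.le
        refine .tail hvb' ⟨hbc, hlen.trans (by gcongr; norm_num), ?_⟩
        -- The first cut edge on a walk shorter than `2 D` would make `b` a border node, whose delay
        -- 0 beats the delay `5 D` of the root `q`.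
        by_contra hne
        have hb : (S₃ b).core.Boundary := (hS₃.boundary_iff b).2 ⟨c, hbc, hlen, Ne.symm hne⟩
        have := hf₄.approx v q d₀ hq b trivial d (hvb'.symm (N.link_symm D h₃))
        simp only [if_pos hb, if_neg hqb, hS₃.inp] at this
        have h4 : 5 * D ≤ 4 * D := calc
          5 * D ≤ 5 * D + d₀ := le_self_add
          _ ≤ (1 + ε) * (0 + d) := this
          _ ≤ 2 * (0 + 2 * D) := by gcongr
          _ = 4 * D := by ring
        exact absurd h4 (not_le.2 (by gcongr; norm_num))
    intro u d hr hd
    rw [hS₅.hist, hS₅.hist]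
    exact ((key u d hr hd).invariant (φ := h₃) fun _ _ h => h.2.2).symm
  · obtain ⟨q, d, hq, hd⟩ := hroot₄ v
    have hqb : (S₃ q).core.Boundary := by
      by_contra hb
      rw [hfl₅ v q d hq, hc₄, if_neg hb] at hv
      exact hv rfl
    obtain ⟨b, hadj, hlen, hne⟩ := (hS₃.boundary_iff q).1 hqb
    have hr : Reach (N.link D h₃) N.len v q d := hq.reach hf₄.parent
    -- At most `10 D` to the border root and `2 D` for its cut edge: this is the origin of `12 D`.
    refine ⟨b, d + N.len s(q, b), .tail (hr.mono fun _ _ h => ⟨h.1, h.2.1, rfl⟩)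
      ⟨hadj, hlen.trans (by gcongr; norm_num), rfl⟩, ?_, ?_⟩
    · calc d + N.len s(q, b) ≤ 10 * D + 2 * D := add_le_add hd hlen
        _ = 12 * D := by ring
    · rw [hS₅.hist, hS₅.hist, hr.invariant (φ := h₃) fun _ _ h => h.2.2]
      exact hne

/-- Passes from program correctness to the required guarantees: a halted configuration is frozen, so
the time limit may exceed the program length. -/
theorem Machine.computesPadded {m : Machine X} {O : Oracle N} {D : ℝ≥0}
    {x : V → X (Fintype.card V)} {K : ℕ} {Post : (V → NodeState) → Prop} (hD : 0 < D)
    (hlen : (m.prog (Fintype.card V)).length ≤ timeLimit V K)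
    (hrad : 2 * (m.rad (Fintype.card V) D : ℝ) ≤ K * logCard V ^ 3 * D)
    (h : m.Achieves N O (Fintype.card V ^ K) (precision (Fintype.card V))
      (m.rad (Fintype.card V) D) (m.prog (Fintype.card V)) 0 (initConfig N m.alg D x).loc
      fun _ S => (∃ h f, Clustered N D (m.rad (Fintype.card V) D) h f S) ∧ Post S) :
    ComputesPadded N m.alg O D x K ∧
      ∃ S : V → NodeState, Post S ∧ outBad N m.alg O D x K = {v | (S v).flag ≠ 0} := by
  obtain ⟨reg, S, ⟨⟨h₀, f, hC⟩, hP⟩, e, hl⟩ := h 0 []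
  have e₀ : (⟨⟨precision (Fintype.card V), m.rad (Fintype.card V) D,
      m.prog (Fintype.card V) ++ [], 0⟩, (initConfig N m.alg D x).loc⟩ : Config m.alg V) =
      initConfig N m.alg D x := by
    rw [List.append_nil]; rfl
  rw [e₀] at e hl
  simp only [← run_eq_runFrom] at e hl
  have hrun : ∀ k, (m.prog (Fintype.card V)).length ≤ k → run N m.alg O D x k =
      ⟨⟨precision (Fintype.card V), m.rad (Fintype.card V) D, [], reg⟩, S⟩ := by
    intro k hk
    obtain ⟨j, rfl⟩ := Nat.exists_eq_add_of_le hk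
    rw [run_eq_runFrom, runFrom_add, ← run_eq_runFrom, e]
    exact runFrom_halt _ _ _ _ _ rfl _
  have hR : (m.rad (Fintype.card V) D : ℝ) ≤ K * logCard V ^ 3 * D :=
    le_trans (by have := (m.rad (Fintype.card V) D).coe_nonneg; linarith) hrad
  have hT := hrun _ hlen
  have hcl : ∀ C ∈ outClusters N m.alg O D x (timeLimit V K), ∀ u ∈ C, ∀ v,
      v ∈ C ↔ (S v).core.hist.headD 0 = (S u).core.hist.headD 0 := by
    rintro C ⟨w, rfl⟩ u hu v
    rw [hT] at hu ⊢
    change (S u).core.hist.headD 0 = (S w).core.hist.headD 0 at hu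
    change (S v).core.hist.headD 0 = (S w).core.hist.headD 0 ↔ _
    rw [hu]
  refine ⟨⟨⟨by rw [hT]; rfl, fun t _ => ?_⟩, fun C hCm => ?_, fun v hv => ?_⟩, S, hP, ?_⟩
  · rcases lt_or_ge t (m.prog (Fintype.card V)).length with ht | ht
    · have := hl t ht
      unfold LegalStep at this ⊢
      revert this
      cases m.alg.op (run N m.alg O D x t).pub with
      | halt => exact id
      | exchange => exact id
      | dist ε R => exact fun h => ⟨h.1.trans (coe_precision _), h.2.trans hR⟩
      | forestAgg R => exact fun h => ⟨h.1.trans hR, h.2⟩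
      | globalAgg => exact id
    · rw [hrun t ht]
      trivial
  · refine (hC.clusterDiam_le C (hcl C hCm)).trans ?_
    rw [← ENNReal.ofReal_coe_nnreal]
    refine ENNReal.ofReal_le_ofReal ?_
    push_cast
    linarith
  · refine ⟨_, ⟨v, rfl⟩, fun u hu => ?_⟩
    change (run N m.alg O D x (timeLimit V K)).loc u |> m.alg.label |> fun a =>
      a = m.alg.label ((run N m.alg O D x (timeLimit V K)).loc v)
    unfold outGood at hv
    rw [Set.mem_ofPred_eq] at hv
    rw [hT] at hv ⊢
    -- The distance is an infimum; the slack up to `2 D` supplies a walk without attaining it.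
    have hlt : wdist N.graph N.len v u < ((2 * D : ℝ≥0) : ℝ≥0∞) :=
      lt_of_le_of_lt hu (by exact_mod_cast lt_mul_of_one_lt_left hD one_lt_two)
    obtain ⟨d, hd, hr⟩ := exists_reach_of_wdist_lt hlt
    have := hC.good v hv u d hr hd
    change (S u).core.hist.headD 0 = (S v).core.hist.headD 0
    rw [this]
  · unfold outBad outGood
    rw [hT]
    rfl

end Run

/-! ## Separating terminals by a sequence of predicates of their identifiers -/

/-- A sequence of predicates of identifiers, and the parameters of the rounds that separate them:
every identifier satisfies at most `depth` predicates, `rounds = depth * width`, and `2 * half + 1`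
thresholds are tried in each round. -/
structure Plan where
  pred : ℕ → ℕ → Prop
  depth : ℕ
  width : ℕ
  half : ℕ

namespace Plan

def rounds (π : Plan) : ℕ := π.width * π.depth

open Classical in
/-- Which of the first `r` predicates hold for `x`. -/
def code (π : Plan) : ℕ → ℕ → List ℕ
  | 0, _ => []
  | r + 1, x => (if π.pred r x then 1 else 0) :: π.code r x

theorem code_sum_mono (π : Plan) (x : ℕ) : Monotone fun r => (π.code r x).sum :=
  monotone_nat_of_le_succ fun r => by simp [code]

/-- The largest delay. -/
def reach (π : Plan) (D : ℝ≥0) : ℝ≥0 := 2 * π.half * (50 * D)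

/-- The threshold `2 j + 1` is acceptable: few nodes lie between its two neighbours. -/
def Acceptable (π : Plan) (reg : ℕ → ℕ) (j : ℕ) : Prop :=
  -- Register `i + 1` holds the red weight at threshold `i`, and register 0 the total weight.
  20 * π.depth * π.width * reg (2 * j + 3) ≤
    20 * π.depth * π.width * reg (2 * j + 1) + π.width * reg (2 * j + 1) + reg 0

open Classical in
def pick (π : Plan) (reg : ℕ → ℕ) : ℕ :=
  if h : ∃ j < π.half, π.Acceptable reg j then h.choose else 0

open Classical in
def growProg (π : Plan) (r : ℕ) (i : (ℕ → ℕ) → ℕ) : List Instr :=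
  [.dist Core.terminal fun reg c => if π.pred r c.inp.ident then 0 else i reg * (50 * c.inp.D),
   .agg fun c => if π.pred r c.inp.ident then 1 else 0]

/-- The final call at the chosen odd threshold need not repeat the measured answer. Only the
measured weights at its two even neighbours enter the analysis. -/
def roundProg (π : Plan) (r : ℕ) : List Instr :=
  (List.range (2 * π.half + 1)).flatMap (fun i => π.growProg r (fun _ => i) ++ [.sum (i + 1)]) ++
    (π.growProg r (fun reg => 2 * π.pick reg + 1) ++ [.cut])

/-- The parameters are such that the rounds succeed. -/
structure Fits (π : Plan) (ε D R : ℝ≥0) (B : ℕ) : Prop where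
  pos : 0 < D
  half_pos : 1 ≤ π.half
  eps_le : ε ≤ 1
  pow_le : (1 + ε : ℝ) ^ π.rounds ≤ 2
  eps_mul_le : 40 * (ε : ℝ) * (1 + π.depth) * π.half ≤ 1
  rad : 4 * (1 + π.depth) * (π.reach D : ℝ) ≤ R
  sum_le : ∀ x ≤ B, (π.code π.rounds x).sum ≤ π.depth
  width_lt : (1 + π.width) * (20 * π.depth) ^ π.half ≤ (20 * π.depth + 1) ^ π.half

/-- Ball growing: every unacceptable `j` multiplies `width * (red weight) + total` by more than `1 +
1 / (20 * depth)`. This quantity stays between the total and `1 + width` times the total, so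
`width_lt` excludes `half` failures. -/
theorem exists_acceptable {π : Plan} {ε D R : ℝ≥0} {B : ℕ} (hπ : π.Fits ε D R B) {reg : ℕ → ℕ}
    (hreg : ∀ i ≤ 2 * π.half, reg (i + 1) ≤ reg 0) : ∃ j < π.half, π.Acceptable reg j := by
  by_contra! hcon
  have hlt : ∀ j < π.half, 20 * π.depth * π.width * reg (2 * j + 1) + π.width * reg (2 * j + 1) +
      reg 0 < 20 * π.depth * π.width * reg (2 * j + 3) := fun j hj => not_le.1 (hcon j hj)
  set x := 20 * π.depth
  set s := π.width
  set b : ℕ → ℕ := fun j => s * reg (2 * j + 1) + reg 0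
  have hb : ∀ j < π.half, (x + 1) * b j < x * b (j + 1) := by
    intro j hj
    have := hlt j hj
    simp only [b, show 2 * (j + 1) + 1 = 2 * j + 3 by ring]
    nlinarith
  have hx : 0 < x := by
    rcases Nat.eq_zero_or_pos x with h | h
    · have := hb 0 hπ.half_pos
      simp [h] at this
    · exact h
  have hpow : ∀ j ≤ π.half, (x + 1) ^ j * b 0 ≤ x ^ j * b j := by
    intro j
    induction j with
    | zero => simp
    | succ j ih =>
      intro hj
      calc (x + 1) ^ (j + 1) * b 0 = (x + 1) * ((x + 1) ^ j * b 0) := by ring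
        _ ≤ (x + 1) * (x ^ j * b j) := Nat.mul_le_mul_left _ (ih (by omega))
        _ = x ^ j * ((x + 1) * b j) := by ring
        _ ≤ x ^ j * (x * b (j + 1)) := Nat.mul_le_mul_left _ (hb j (by omega)).le
        _ = x ^ (j + 1) * b (j + 1) := by ring
  obtain ⟨k, hk⟩ : ∃ k, π.half = k + 1 := ⟨π.half - 1, by have := hπ.half_pos; omega⟩
  have h1 := hpow k (by omega)
  have h2 := hb k (by omega)
  have h3 : b (k + 1) ≤ (1 + s) * reg 0 := by
    have := hreg (2 * (k + 1)) (by omega)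
    calc s * reg (2 * (k + 1) + 1) + reg 0 ≤ s * reg 0 + reg 0 := by gcongr
      _ = (1 + s) * reg 0 := by ring
  have h4 : reg 0 ≤ b 0 := Nat.le_add_left _ _
  have h5 := hπ.width_lt
  rw [hk] at h5
  have : (x + 1) ^ (k + 1) * b 0 < (x + 1) ^ (k + 1) * b 0 := calc
    (x + 1) ^ (k + 1) * b 0 = (x + 1) * ((x + 1) ^ k * b 0) := by ring
    _ ≤ (x + 1) * (x ^ k * b k) := by gcongr
    _ = x ^ k * ((x + 1) * b k) := by ring
    _ < x ^ k * (x * b (k + 1)) := by gcongr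
    _ ≤ x ^ k * (x * ((1 + s) * reg 0)) := by gcongr
    _ = (1 + s) * x ^ (k + 1) * reg 0 := by ring
    _ ≤ (x + 1) ^ (k + 1) * b 0 := by gcongr
  exact lt_irrefl _ this

theorem acceptable_pick {π : Plan} {ε D R : ℝ≥0} {B : ℕ} (hπ : π.Fits ε D R B) {reg : ℕ → ℕ}
    (hreg : ∀ i ≤ 2 * π.half, reg (i + 1) ≤ reg 0) :
    π.pick reg < π.half ∧ π.Acceptable reg (π.pick reg) := by
  have h := exists_acceptable hπ hreg
  rw [pick, dif_pos h]
  exact h.choose_spec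

/-- The state of the separation of the terminals `Q` before round `r`. -/
structure Invariant (π : Plan) (N : Network V) [Fintype V] (D ε : ℝ≥0) (μ : V → ℕ) (r : ℕ)
    (h : V → List ℕ) (Q : Set V) : Prop where
  -- A potential: a red round raises `(h v).sum` and so pays for one more `reach`; any other round
  -- costs only a factor `1 + ε`.
  near : ∀ v, ∃ q ∈ Q, ∃ d, Reach (N.link D h) N.len q v d ∧
    (d + π.reach D : ℝ) ≤ (1 + ε) ^ r * (1 + (h v).sum) * π.reach D
  code : ∀ q ∈ Q, h q = π.code r (N.ident q)
  bad : ∃ B : Finset V, (∀ v ∉ B, ∀ u d, Reach (N.link D fun _ => []) N.len v u d → d ≤ 12 * D →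
      Reach (N.link D h) N.len v u d) ∧
    20 * π.depth * π.width * ∑ v ∈ B, μ v ≤ π.width * ∑ v, μ v * (h v).sum + r * ∑ v, μ v

open Classical in
/-- `f` is the forest for threshold `i` of round `r`; the flags tell the sides of the nodes. -/
structure Sweep (π : Plan) (N : Network V) (D ε R : ℝ≥0) (h : V → List ℕ) (Q : Set V) (r i : ℕ)
    (f : Pointers V) (g : V → ℕ) : Prop where
  answers : Answers (N.link D h) N.len Q
    (fun v => if π.pred r (N.ident v) then 0 else i * (50 * D)) ε R f
  flag : ∀ v q d, RootPath f N.len v q d → g v = if π.pred r (N.ident q) then 1 else 0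

/-! ### One round of separation -/

section Round

variable [Fintype V] {π : Plan} {N : Network V} {D ε R : ℝ≥0} {μ : V → ℕ} {r i j : ℕ}
  {h : V → List ℕ} {Q : Set V} {B : ℕ} {f f' : Pointers V} {g g' : V → ℕ}

theorem Invariant.exists_code (hI : π.Invariant N D ε μ r h Q) (v : V) :
    ∃ q ∈ Q, ∃ d, Reach (N.link D h) N.len q v d ∧ h v = π.code r (N.ident q) := by
  obtain ⟨q, hq, d, hd, -⟩ := hI.near v
  exact ⟨q, hq, d, hd, by rw [← hI.code q hq]; exact (hd.invariant fun _ _ h => h.2.2).symm⟩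

theorem Invariant.near_le (hI : π.Invariant N D ε μ r h Q) (hπ : π.Fits ε D R B)
    (hr : r ≤ π.rounds) (hB : ∀ v, N.ident v ≤ B) (v : V) :
    ∃ q ∈ Q, ∃ d, Reach (N.link D h) N.len q v d ∧
      (d + π.reach D : ℝ) ≤ 2 * (1 + π.depth) * π.reach D := by
  obtain ⟨q, hq, d, hd, hle⟩ := hI.near v
  refine ⟨q, hq, d, hd, hle.trans ?_⟩
  obtain ⟨q', -, -, -, e⟩ := hI.exists_code v
  have hsum : ((h v).sum : ℝ) ≤ π.depth := by
    rw [e]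
    exact_mod_cast (π.code_sum_mono _ hr).trans (hπ.sum_le _ (hB q'))
  have hpow : (1 + ε : ℝ) ^ r ≤ 2 :=
    (pow_le_pow_right₀ (le_add_of_nonneg_right ε.coe_nonneg) hr).trans hπ.pow_le
  gcongr

open Classical in
theorem Invariant.exists_rootPath (hI : π.Invariant N D ε μ r h Q) (hπ : π.Fits ε D R B)
    (hr : r ≤ π.rounds) (hB : ∀ v, N.ident v ≤ B) (hi : i ≤ 2 * π.half)
    (hf : Answers (N.link D h) N.len Q
      (fun v => if π.pred r (N.ident v) then 0 else i * (50 * D)) ε R f) (v : V) :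
    ∃ q d, RootPath f N.len v q d ∧ (d : ℝ) ≤ 4 * (1 + π.depth) * π.reach D ∧ d ≤ R := by
  obtain ⟨q, hq, d, hd, hle⟩ := hI.near_le hπ hr hB v
  have hdel : ((if π.pred r (N.ident q) then 0 else i * (50 * D) : ℝ≥0) : ℝ) ≤ π.reach D := by
    split_ifs
    · exact NNReal.coe_nonneg _
    · have : (i : ℝ) ≤ 2 * π.half := by exact_mod_cast hi
      simp only [reach]
      push_cast
      gcongr
  have hR := hπ.rad
  have hnn : (0 : ℝ) ≤ (1 + π.depth) * π.reach D := by positivity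
  obtain ⟨q', d', hp⟩ := hf.covers v q hq d hd (by
    rw [← NNReal.coe_le_coe, NNReal.coe_add]
    linarith)
  have hε : (ε : ℝ) ≤ 1 := by exact_mod_cast hπ.eps_le
  have hd' : (d' : ℝ) ≤ 4 * (1 + π.depth) * π.reach D := by
    have h1 := NNReal.coe_le_coe.2 (hf.approx v q' d' hp q hq d hd)
    rw [NNReal.coe_add, NNReal.coe_mul, NNReal.coe_add, NNReal.coe_add, NNReal.coe_one] at h1
    set a : ℝ := ((if π.pred r (N.ident q) then 0 else i * (50 * D) : ℝ≥0) : ℝ)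
    have h2 : (0 : ℝ) ≤ ((if π.pred r (N.ident q') then 0 else i * (50 * D) : ℝ≥0) : ℝ) :=
      NNReal.coe_nonneg _
    have h3 : (1 + ε : ℝ) * (a + d) ≤ 2 * (2 * (1 + π.depth) * π.reach D) := by
      have : (0:ℝ) ≤ d := d.coe_nonneg
      gcongr
      · linarith
      · linarith
    linarith
  exact ⟨q', d', hp, hd', by rw [← NNReal.coe_le_coe]; linarith⟩

/-- Suppose `y` had a blue root. Each of the two roots competes at the other node, and adding the
two approximation inequalities cancels the tree depths, leaving `(j - i) * 50 D ≤ 2 * d + error ≤ 24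
D + 25 D`. -/
theorem Invariant.sweep_mono (hI : π.Invariant N D ε μ r h Q) (hπ : π.Fits ε D R B)
    (hr : r ≤ π.rounds) (hB : ∀ v, N.ident v ≤ B) (hij : i < j) (hj : j ≤ 2 * π.half)
    (hf : π.Sweep N D ε R h Q r i f g) (hf' : π.Sweep N D ε R h Q r j f' g') {x y : V} {d : ℝ≥0}
    (hg : g x ≠ 0) (hxy : Reach (N.link D h) N.len x y d) (hd : d ≤ 12 * D) : g' y ≠ 0 := by
  obtain ⟨q₁, d₁, hp₁, hb₁, -⟩ := hI.exists_rootPath hπ hr hB (by omega) hf.answers x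
  obtain ⟨q₂, d₂, hp₂, hb₂, -⟩ := hI.exists_rootPath hπ hr hB hj hf'.answers y
  rw [hf.flag x q₁ d₁ hp₁] at hg
  have hP₁ : π.pred r (N.ident q₁) := by by_contra hP; simp [hP] at hg
  rw [hf'.flag y q₂ d₂ hp₂]
  by_contra hP₂
  have hP₂ : ¬ π.pred r (N.ident q₂) := by intro hP; simp [hP] at hP₂
  have hs := N.link_symm D h
  have r₁ : Reach (N.link D h) N.len q₁ y (d₁ + d) :=
    ((hp₁.reach hf.answers.parent).symm hs).trans hxy
  have r₂ : Reach (N.link D h) N.len q₂ x (d₂ + d) :=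
    ((hp₂.reach hf'.answers.parent).symm hs).trans (hxy.symm hs)
  have a₁ := NNReal.coe_le_coe.2
    (hf'.answers.approx y q₂ d₂ hp₂ q₁ (hf.answers.source x q₁ d₁ hp₁) _ r₁)
  have a₂ := NNReal.coe_le_coe.2
    (hf.answers.approx x q₁ d₁ hp₁ q₂ (hf'.answers.source y q₂ d₂ hp₂) _ r₂)
  simp only [if_pos hP₁, if_neg hP₂] at a₁ a₂
  push_cast at a₁ a₂
  have hD : (0 : ℝ) < D := hπ.pos
  have hd : (d : ℝ) ≤ 12 * D := by exact_mod_cast hd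
  have hij' : (i : ℝ) + 1 ≤ j := by exact_mod_cast hij
  have hj' : (j : ℝ) ≤ 2 * π.half := by exact_mod_cast hj
  have hm : (1 : ℝ) ≤ π.half := by exact_mod_cast hπ.half_pos
  have hθ : (π.reach D : ℝ) = 2 * π.half * (50 * D) := by simp [reach]
  have hθ₂ : (j : ℝ) * (50 * D) ≤ π.reach D := by rw [hθ]; gcongr
  have hθ₁ : (i : ℝ) * (50 * D) + 50 * D ≤ j * (50 * D) := by nlinarith
  have hθD : 24 * (D : ℝ) ≤ π.reach D := by rw [hθ]; nlinarith
  have hp0 : (0 : ℝ) ≤ π.depth := Nat.cast_nonneg _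
  have hθp : (π.reach D : ℝ) ≤ (1 + π.depth) * π.reach D := by
    have := (π.reach D).coe_nonneg
    nlinarith
  -- In units of `(1 + depth) * reach`: 4 for each tree depth, 1 for the delay and 1 for `2 * d`.
  have hε : (ε : ℝ) * (d₁ + d + (i * (50 * D) + (d₂ + d))) ≤ 25 * D := by
    calc (ε : ℝ) * (d₁ + d + (i * (50 * D) + (d₂ + d)))
        ≤ ε * (10 * ((1 + π.depth) * π.reach D)) := by
          have := ε.coe_nonneg
          gcongr
          linarith
      _ = (40 * (ε : ℝ) * (1 + π.depth) * π.half) * (25 * D) := by rw [hθ]; ring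
      _ ≤ 1 * (25 * D) := by gcongr; exact hπ.eps_mul_le
      _ = 25 * D := one_mul _
  linarith

-- Nodes near the cut at threshold `i + 1` are red at `i + 2` but not at `i`, so `hw` bounds their
-- weight. Nodes red at `i` are red at `i + 1`, so their weight is charged to the growth of the
-- history sums.
open Classical in
theorem Invariant.succ (hI : π.Invariant N D ε μ r h Q) (hπ : π.Fits ε D R B)
    (hr : r < π.rounds) (hB : ∀ v, N.ident v ≤ B) (hi : i + 2 ≤ 2 * π.half)
    (hf : π.Sweep N D ε R h Q r (i + 1) f g)
    {f₀ f₁ : Pointers V} {g₀ g₁ : V → ℕ} (hf₀ : π.Sweep N D ε R h Q r i f₀ g₀)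
    (hf₁ : π.Sweep N D ε R h Q r (i + 2) f₁ g₁)
    (hw : 20 * π.depth * π.width * (∑ v, if g₁ v = 0 then 0 else μ v) ≤
      20 * π.depth * π.width * (∑ v, if g₀ v = 0 then 0 else μ v) +
        π.width * (∑ v, if g₀ v = 0 then 0 else μ v) + ∑ v, μ v) :
    π.Invariant N D ε μ (r + 1) (fun v => g v :: h v) {v | f v = some none} := by
  have hroot := hI.exists_rootPath hπ hr.le hB (by omega) hf.answers
  have hg01 : ∀ v, g v = 0 ∨ g v = 1 := by
    intro v
    obtain ⟨q, d, hp, -⟩ := hroot v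
    rw [hf.flag v q d hp]
    split_ifs <;> simp
  have hsame : ∀ u v q d d', RootPath f N.len u q d → RootPath f N.len v q d' → g u = g v :=
    fun u v q d d' hu hv => by rw [hf.flag u q d hu, hf.flag v q d' hv]
  refine ⟨fun v => ?_, fun q hq => ?_, ?_⟩
  · obtain ⟨q, hq, d, hd, hle⟩ := hI.near v
    obtain ⟨q', d', hp, -, -⟩ := hroot v
    have hr' : Reach (N.link D fun v => g v :: h v) N.len v q' d' :=
      hp.reach_of_root_invariant fun u p hup q d d' hu hp => by
        obtain ⟨h1, h2, h3⟩ := hf.answers.parent u p hup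
        exact ⟨h1, h2, congrArg₂ List.cons (hsame u p q d d' hu hp) h3⟩
    refine ⟨q', hp.isRoot, d', hr'.symm (N.link_symm D _), ?_⟩
    have ha := NNReal.coe_le_coe.2 (hf.answers.approx v q' d' hp q hq d hd)
    have hε : (0 : ℝ) ≤ ε := ε.coe_nonneg
    have hΘ : (0 : ℝ) ≤ π.reach D := (π.reach D).coe_nonneg
    set θ : ℝ≥0 := ((i + 1 : ℕ) : ℝ≥0) * (50 * D) with hθ
    have hθΘ : (θ : ℝ) ≤ π.reach D := by
      have : ((i + 1 : ℕ) : ℝ) ≤ 2 * π.half := by exact_mod_cast (by omega : i + 1 ≤ 2 * π.half)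
      simp only [hθ, reach, NNReal.coe_mul, NNReal.coe_natCast, NNReal.coe_ofNat]
      gcongr
    have hdel : ((if π.pred r (N.ident q) then 0 else θ : ℝ≥0) : ℝ) ≤ θ := by
      split_ifs
      · exact θ.coe_nonneg
      · exact le_rfl
    set a : ℝ := ((if π.pred r (N.ident q) then 0 else θ : ℝ≥0) : ℝ)
    rw [NNReal.coe_add, NNReal.coe_mul, NNReal.coe_add, NNReal.coe_add, NNReal.coe_one] at ha
    have hb : (1 + ε : ℝ) * (a + d) ≤ (1 + ε) * (θ + d) := by gcongr
    have hmain : (1 + ε : ℝ) * (d + π.reach D) ≤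
        (1 + ε) ^ (r + 1) * (1 + (h v).sum) * π.reach D := by
      rw [pow_succ']
      calc (1 + ε : ℝ) * (d + π.reach D)
          ≤ (1 + ε) * ((1 + ε) ^ r * (1 + (h v).sum) * π.reach D) := by gcongr
        _ = _ := by ring
    have hεθ : (ε : ℝ) * θ ≤ ε * π.reach D := by gcongr
    rw [List.sum_cons, hf.flag v q' d' hp]
    -- A red node pays a whole `reach`, since its old terminal may have had delay `θ`. At other
    -- nodes the new root has delay `θ` as well, which cancels up to the factor `1 + ε`.
    by_cases hP : π.pred r (N.ident q')
    · simp only [if_pos hP, NNReal.coe_zero] at ha ⊢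
      have h1 : (1 : ℝ) ≤ (1 + ε) ^ (r + 1) := one_le_pow₀ (by linarith)
      have h2 : (π.reach D : ℝ) ≤ (1 + ε) ^ (r + 1) * π.reach D := le_mul_of_one_le_left hΘ h1
      rw [Nat.cast_add, Nat.cast_one]
      have e : (1 + ε : ℝ) ^ (r + 1) * (1 + (1 + ((h v).sum : ℝ))) * π.reach D =
        (1 + ε) ^ (r + 1) * (1 + (h v).sum) * π.reach D + (1 + ε) ^ (r + 1) * π.reach D := by ring
      rw [e]
      linarith
    · simp only [if_neg hP] at ha ⊢
      rw [zero_add]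
      linarith
  · have hp : RootPath f N.len q q 0 := .root q hq
    change g q :: h q = _
    rw [hf.flag q q 0 hp, hI.code q (hf.answers.source q q 0 hp), Plan.code]
  · obtain ⟨C, hC, hCw⟩ := hI.bad
    -- The nodes that become exceptional in this round: those near a node of the other colour.
    let A : Finset V := {v | ∃ u d, Reach (N.link D h) N.len v u d ∧ d ≤ 12 * D ∧ g u ≠ g v}
    have m₀ : ∀ x y d, g₀ x ≠ 0 → Reach (N.link D h) N.len x y d → d ≤ 12 * D → g y ≠ 0 :=
      fun x y d hx hxy hd => hI.sweep_mono hπ hr.le hB (by omega) (by omega) hf₀ hf hx hxy hd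
    have m₁ : ∀ x y d, g x ≠ 0 → Reach (N.link D h) N.len x y d → d ≤ 12 * D → g₁ y ≠ 0 :=
      fun x y d hx hxy hd => hI.sweep_mono hπ hr.le hB (by omega) (by omega) hf hf₁ hx hxy hd
    have hA : ∀ v, (if v ∈ A then μ v else 0) + (if g₀ v = 0 then 0 else μ v) ≤
        if g₁ v = 0 then 0 else μ v := by
      intro v
      by_cases hv : v ∈ A
      · obtain ⟨u, d, hvu, hd, hne⟩ : ∃ u d, Reach (N.link D h) N.len v u d ∧ d ≤ 12 * D ∧
          g u ≠ g v := by simpa [A] using hv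
        have h0 : g₀ v = 0 := by
          by_contra h0
          have h1 := m₀ v v 0 h0 .refl zero_le
          have h2 := m₀ v u d h0 hvu hd
          rcases hg01 u with hu | hu <;> rcases hg01 v with hv | hv <;> omega
        have h1 : g₁ v ≠ 0 := by
          by_cases hgv : g v = 0
          · exact m₁ u v d (by omega) (hvu.symm (N.link_symm D h)) hd
          · exact m₁ v v 0 hgv .refl zero_le
        simp [hv, h0, h1]
      · by_cases h0 : g₀ v = 0
        · simp [hv, h0]
        · have h1 := m₁ v v 0 (m₀ v v 0 h0 .refl zero_le) .refl zero_le
          simp [hv, h0, h1]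
    have hAs : ∑ v ∈ A, μ v + (∑ v, if g₀ v = 0 then 0 else μ v) ≤
        ∑ v, if g₁ v = 0 then 0 else μ v := by
      have := Finset.sum_le_sum fun v (_ : v ∈ Finset.univ) => hA v
      rw [Finset.sum_add_distrib, Finset.sum_ite_mem, Finset.univ_inter] at this
      exact this
    have hgs : (∑ v, if g₀ v = 0 then 0 else μ v) ≤ ∑ v, μ v * g v := by
      refine Finset.sum_le_sum fun v _ => ?_
      by_cases h0 : g₀ v = 0
      · simp [h0]
      · have := m₀ v v 0 h0 .refl zero_le
        rw [if_neg h0]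
        exact Nat.le_mul_of_pos_right _ (Nat.pos_of_ne_zero this)
    refine ⟨C ∪ A, fun v hv u d hvu hd => ?_, ?_⟩
    · rw [Finset.mem_union, not_or] at hv
      have key : ∀ u d, Reach (N.link D h) N.len v u d → d ≤ 12 * D →
          Reach (N.link D fun v => g v :: h v) N.len v u d ∧ g u = g v := by
        intro u d hvu hd
        have hflag : ∀ u d, Reach (N.link D h) N.len v u d → d ≤ 12 * D → g u = g v := by
          intro u d hvu hd
          by_contra hne
          exact hv.2 (by simpa [A] using ⟨u, d, hvu, hd, hne⟩)
        refine ⟨?_, hflag u d hvu hd⟩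
        induction hvu with
        | refl => exact .refl
        | @tail b c d hvb hbc ih =>
          have hd' : d ≤ 12 * D := le_self_add.trans hd
          exact .tail (ih hd') ⟨hbc.1, hbc.2.1, congrArg₂ List.cons
            ((hflag b d hvb hd').trans (hflag c _ (.tail hvb hbc) hd).symm) hbc.2.2⟩
      exact (key u d (hC v hv.1 u d hvu hd) hd).1
    · set a₀ := ∑ v, if g₀ v = 0 then 0 else μ v
      set a₁ := ∑ v, if g₁ v = 0 then 0 else μ v
      have hU : ∑ v ∈ C ∪ A, μ v ≤ ∑ v ∈ C, μ v + ∑ v ∈ A, μ v := by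
        rw [← Finset.sum_union_inter]; exact Nat.le_add_right _ _
      have hsum : ∑ v, μ v * (g v :: h v).sum = ∑ v, μ v * g v + ∑ v, μ v * (h v).sum := by
        rw [← Finset.sum_add_distrib]
        exact Finset.sum_congr rfl fun v _ => by rw [List.sum_cons]; ring
      rw [hsum]
      have h1 := Nat.mul_le_mul_left (20 * π.depth * π.width) hU
      have h2 := Nat.mul_le_mul_left (20 * π.depth * π.width) hAs
      have h3 := Nat.mul_le_mul_left π.width hgs
      rw [mul_add] at h1 h2
      rw [mul_add, add_mul, one_mul]
      linarith

end Round

end Plan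

/-! ## The program of the rounds -/

section Run

variable [Fintype V] {N : Network V} {X : ℕ → Type} {m : Machine X} {O : Oracle N} {M : ℕ}
  {ε R D : ℝ≥0} {reg : ℕ → ℕ} {S : V → NodeState}

theorem Machine.achieves_flatMap_range {n : ℕ} {F : ℕ → List Instr}
    (I : ℕ → (ℕ → ℕ) → (V → NodeState) → Prop)
    (step : ∀ i < n, ∀ reg S, I i reg S → m.Achieves N O M ε R (F i) reg S (I (i + 1)))
    (h0 : I 0 reg S) : m.Achieves N O M ε R ((List.range n).flatMap F) reg S (I n) := by
  induction n with
  | zero => exact .nil h0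
  | succ n ih =>
    rw [List.range_succ, List.flatMap_append, List.flatMap_singleton]
    exact .append ((ih fun i hi => step i (by omega)).mono fun reg S h => step n (by omega) reg S h)

namespace Plan

variable {π : Plan} {μ : V → ℕ} {δ : V → ℝ≥0} {r i : ℕ} {h : V → List ℕ} {Q : Set V} {B : ℕ}

open Classical in
theorem achieves_growProg (hO : IsDistOracle N O) (hS : Represents N D μ δ h Q S)
    (hI : π.Invariant N D ε μ r h Q) (hπ : π.Fits ε D R B) (hr : r < π.rounds)
    (hB : ∀ v, N.ident v ≤ B) (hM : 1 ≤ M) {θ : (ℕ → ℕ) → ℕ} (hθ : θ reg = i)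
    (hi : i ≤ 2 * π.half) {Post : (ℕ → ℕ) → (V → NodeState) → Prop}
    (hP : ∀ f S', π.Sweep N D ε R h Q r i f (fun v => (S' v).flag) → PointsTo N f S' →
      (∀ v, (S' v).flag ≤ M) → Represents N D μ δ h Q S' → Post reg S') :
    m.Achieves N O M ε R (π.growProg r θ) reg S Post := by
  refine .cons (Machine.achieves_dist hO hS fun f S₁ hf ht₁ hc₁ _ => ?_)
  have hS₁ := hS.of_core_eq hc₁
  have hsrc : {v | (S v).core.terminal} = Q := Set.ext hS.terminal
  simp only [hsrc, hS.inp, hθ] at hf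
  have hroot := hI.exists_rootPath hπ hr.le hB hi hf
  refine Machine.achieves_agg ht₁ (fun v p hp => (hf.parent v p hp).1)
    (fun v => (hroot v).imp fun _ h => h.imp fun _ h => ⟨h.1, h.2.2⟩)
    (fun v => by split_ifs <;> omega) fun S₂ hfl₂ ht₂ hc₂ => ?_
  simp only [hS₁.inp] at hfl₂
  refine hP f S₂ ⟨hf, hfl₂⟩ ht₂ (fun v => ?_) (hS₁.of_core_eq hc₂)
  obtain ⟨q, d, hq, -⟩ := hroot v
  rw [hfl₂ v q d hq]
  split_ifs <;> omega

theorem achieves_roundProg (hO : IsDistOracle N O) (hS : Represents N D μ δ h Q S)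
    (hI : π.Invariant N D ε μ r h Q) (hπ : π.Fits ε D R B) (hr : r < π.rounds)
    (hB : ∀ v, N.ident v ≤ B) (hM : 1 ≤ M) (hμ : ∀ v, μ v ≤ M) (hreg : reg 0 = ∑ v, μ v) :
    m.Achieves N O M ε R (π.roundProg r) reg S fun reg' S' => reg' 0 = ∑ v, μ v ∧
      ∃ h' Q', Represents N D μ δ h' Q' S' ∧ π.Invariant N D ε μ (r + 1) h' Q' := by
  let J : ℕ → (ℕ → ℕ) → (V → NodeState) → Prop := fun k reg S =>
    Represents N D μ δ h Q S ∧ reg 0 = ∑ v, μ v ∧ ∀ i < k, ∃ f g, π.Sweep N D ε R h Q r i f g ∧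
      reg (i + 1) = ∑ v, if g v = 0 then 0 else μ v
  have hJ := Machine.achieves_flatMap_range (m := m) (N := N) (O := O) (M := M) (ε := ε) (R := R)
    (reg := reg) (S := S) (n := 2 * π.half + 1)
    (F := fun i => π.growProg r (fun _ => i) ++ [.sum (i + 1)]) J ?_ ⟨hS, hreg, by simp⟩
  · refine .append (hJ.mono ?_)
    rintro reg S ⟨hS, hreg, hsweep⟩
    have hle : ∀ i ≤ 2 * π.half, reg (i + 1) ≤ reg 0 := by
      intro i hi
      obtain ⟨f, g, -, e⟩ := hsweep i (by omega)
      rw [e, hreg]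
      refine Finset.sum_le_sum fun v _ => ?_
      split_ifs <;> simp
    obtain ⟨hlt, hacc⟩ := acceptable_pick hπ hle
    obtain ⟨f₀, g₀, hf₀, e₀⟩ := hsweep (2 * π.pick reg) (by omega)
    obtain ⟨f₁, g₁, hf₁, e₁⟩ := hsweep (2 * π.pick reg + 2) (by omega)
    refine .append (achieves_growProg hO hS hI hπ hr hB hM rfl (by omega)
      fun f S₁ hf ht₁ hfl hS₁ => ?_)
    refine Machine.achieves_cut hS₁ ht₁ hfl fun S₂ hS₂ => ⟨hreg, _, _, hS₂, ?_⟩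
    refine hI.succ hπ hr hB (by omega) hf hf₀ hf₁ ?_
    rw [← e₀, ← e₁, ← hreg]
    exact hacc
  · rintro i hi reg S ⟨hS, hreg, hsweep⟩
    refine .append (achieves_growProg hO hS hI hπ hr hB hM rfl (by omega)
      fun f S₁ hf _ _ hS₁ => ?_)
    refine Machine.achieves_sum hS₁ hμ ⟨hS₁, ?_, fun j hj => ?_⟩
    · rw [Function.update_of_ne (by omega), hreg]
    · rcases Nat.lt_succ_iff_lt_or_eq.1 hj with hj | rfl
      · rw [Function.update_of_ne (by omega)]
        exact hsweep j hj
      · exact ⟨f, _, hf, Function.update_self _ _ _⟩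

theorem achieves_rounds (hO : IsDistOracle N O) (hS : Represents N D μ δ h Q S)
    (hI : π.Invariant N D ε μ 0 h Q) (hπ : π.Fits ε D R B)
    (hB : ∀ v, N.ident v ≤ B) (hM : 1 ≤ M) (hμ : ∀ v, μ v ≤ M) (hreg : reg 0 = ∑ v, μ v) :
    m.Achieves N O M ε R ((List.range π.rounds).flatMap π.roundProg) reg S fun _ S' =>
      ∃ h' Q', Represents N D μ δ h' Q' S' ∧ π.Invariant N D ε μ π.rounds h' Q' :=
  (Machine.achieves_flatMap_range (fun r reg S => reg 0 = ∑ v, μ v ∧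
    ∃ h' Q', Represents N D μ δ h' Q' S ∧ π.Invariant N D ε μ r h' Q')
    (fun _ hr _ _ ⟨hreg, _, _, hS, hI⟩ => achieves_roundProg hO hS hI hπ hr hB hM hμ hreg)
    ⟨hreg, h, Q, hS, hI⟩).mono fun _ _ h => h.2

theorem length_roundProg (π : Plan) (r : ℕ) : (π.roundProg r).length = 6 * π.half + 6 := by
  simp [roundProg, growProg, List.length_flatMap]
  ring

end Plan

end Run

/-! ## Few nodes: the clusters are the components of short edges -/

/-- A simple path has fewer than `n` edges, each of length at most `12 D`. -/
theorem Network.link_exists_short [Fintype V] {N : Network V} {D : ℝ≥0} {h : V → List ℕ}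
    {u v : V} {d : ℝ≥0} (hr : Reach (N.link D h) N.len u v d) :
    ∃ d', Reach (N.link D h) N.len u v d' ∧ d' ≤ 12 * Fintype.card V * D := by
  classical
  let H : SimpleGraph V :=
    { Adj := N.link D h
      symm := ⟨N.link_symm D h⟩
      loopless := ⟨fun _ h => N.graph.loopless.irrefl _ h.1⟩ }
  obtain ⟨p, -⟩ := Reach.exists_walk (H := H) hr
  refine ⟨_, Reach.of_walk (H := H) p.bypass, ?_⟩
  have hlen : p.bypass.length ≤ Fintype.card V := (p.bypass_isPath.length_lt).le
  have : ∀ x ∈ p.bypass.edges.map N.len, x ≤ 12 * D := by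
    intro x hx
    obtain ⟨e, he, rfl⟩ := List.mem_map.1 hx
    have := p.bypass.edges_subset_edgeSet he
    induction e with
    | h a b => exact (show N.link D h a b from this).2.1
  refine (List.sum_le_card_nsmul _ _ this).trans ?_
  rw [List.length_map, SimpleGraph.Walk.length_edges, nsmul_eq_mul]
  calc (p.bypass.length : ℝ≥0) * (12 * D) ≤ Fintype.card V * (12 * D) := by gcongr
    _ = 12 * Fintype.card V * D := by ring

section Run

variable [Fintype V] {N : Network V} {X : ℕ → Type} {m : Machine X} {O : Oracle N} {M : ℕ}
  {ε R D : ℝ≥0} {reg : ℕ → ℕ} {S : V → NodeState} {μ : V → ℕ}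

/-- Delays grow by a factor 3 with the identifier while the approximation loses at most 2, so all
nodes of a component of short edges agree on one root and there are no borders. -/
theorem Machine.achieves_components {B : ℕ} (hO : IsDistOracle N O)
    (hS : Represents N D μ (fun v => 3 ^ (N.ident v + 1) * (12 * Fintype.card V * D))
      (fun _ => []) Set.univ S) (hD : 0 < D) (hε : ε ≤ 1)
    (hB : ∀ v, N.ident v ≤ B) (hM : 1 ≤ M) (hBM : B ≤ M)
    (hR : (2 * 3 ^ (B + 1) * 12 * Fintype.card V + 10) * D ≤ R) :
    m.Achieves N O M ε R clusterProg reg S fun _ S' =>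
      (∃ h f, Clustered N D R h f S') ∧ ∀ v, (S' v).flag = 0 := by
  have h1ε : 1 + ε ≤ 2 := by rw [← one_add_one_eq_two]; gcongr
  refine (achieves_clusterProg hO hS hD hε ?_ hM (fun v => (hB v).trans hBM) fun v => ?_).mono ?_
  · refine le_trans ?_ hR
    gcongr
    exact le_add_self
  · refine ⟨v, trivial, 0, .refl, le_trans ?_ hR⟩
    calc 2 * ((3 : ℝ≥0) ^ (N.ident v + 1) * (12 * Fintype.card V * D) + 0)
        = 2 * 3 ^ (N.ident v + 1) * 12 * Fintype.card V * D := by ring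
      _ ≤ 2 * 3 ^ (B + 1) * 12 * Fintype.card V * D := by
        gcongr
        · norm_num
        · exact hB v
      _ ≤ _ := by gcongr; exact le_self_add
  · rintro - S' ⟨f, hf, hC⟩
    refine ⟨⟨_, f, hC⟩, fun v => ?_⟩
    by_contra hv
    obtain ⟨u, d, hr, -, hne⟩ := hC.bad v hv
    have hs := N.link_symm D fun _ => []
    have key : ∀ u v d, Reach (N.link D fun _ => []) N.len u v d → ∀ q q' d₁ d₂,
        RootPath f N.len u q d₁ → RootPath f N.len v q' d₂ → N.ident q' ≤ N.ident q := by
      intro u v d hr q q' d₁ d₂ hq hq'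
      by_contra! hlt
      have hqv := (((hq.reach hf.parent).symm hs).trans hr)
      obtain ⟨d₃, h₃, hle⟩ := Network.link_exists_short hqv
      have ha := hf.approx v q' d₂ hq' q trivial d₃ h₃
      have hY : 0 < 12 * (Fintype.card V : ℝ≥0) * D := by
        have : 0 < Fintype.card V := Fintype.card_pos_iff.2 ⟨v⟩
        positivity
      set Y := 12 * (Fintype.card V : ℝ≥0) * D
      have h3 : 3 ≤ (3 : ℝ≥0) ^ (N.ident q + 1) := le_self_pow₀ (by norm_num) (by omega)
      have : 3 * 3 ^ (N.ident q + 1) * Y < 3 * 3 ^ (N.ident q + 1) * Y := calc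
        3 * 3 ^ (N.ident q + 1) * Y = 3 ^ (N.ident q + 1 + 1) * Y := by rw [pow_succ' 3 (_ + 1)]
        _ ≤ 3 ^ (N.ident q' + 1) * Y := by
          gcongr
          · norm_num
          · exact hlt
        _ ≤ 3 ^ (N.ident q' + 1) * Y + d₂ := le_self_add
        _ ≤ (1 + ε) * (3 ^ (N.ident q + 1) * Y + d₃) := ha
        _ ≤ 2 * (3 ^ (N.ident q + 1) * Y + Y) := by gcongr
        _ = 2 * 3 ^ (N.ident q + 1) * Y + 2 * Y := by ring
        _ < 2 * 3 ^ (N.ident q + 1) * Y + 3 ^ (N.ident q + 1) * Y := by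
          gcongr
          exact lt_of_lt_of_le (by norm_num) h3
        _ = 3 * 3 ^ (N.ident q + 1) * Y := by ring
      exact lt_irrefl _ this
    obtain ⟨q, d₁, hq, -⟩ := hC.rooted u
    obtain ⟨q', d₂, hq', -⟩ := hC.rooted v
    refine hne ?_
    rw [hC.hist u q d₁ hq, hC.hist v q' d₂ hq',
      le_antisymm (key _ _ _ hr _ _ _ _ hq' hq) (key _ _ _ (hr.symm hs) _ _ _ _ hq hq')]

/-! ## Many nodes: terminals are separated in rounds -/

-- Terminals in one component have equal codes, hence coincide, so only exceptional nodes of the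
-- invariant can be flagged.
open Classical in
theorem Plan.achieves_partition {π : Plan} {B : ℕ} (hO : IsDistOracle N O)
    (hS : Represents N D μ 0 (fun _ => []) Set.univ S) (hflag : ∀ v, (S v).flag = 1)
    (hπ : π.Fits ε D R B) (hR : 10 * D ≤ R) (hB : ∀ v, N.ident v ≤ B)
    (hinj : ∀ x ≤ B, ∀ y ≤ B, π.code π.rounds x = π.code π.rounds y → x = y)
    (hpos : 0 < π.rounds) (hM : 1 ≤ M) (hBM : B ≤ M) (hμ : ∀ v, μ v ≤ M) :
    m.Achieves N O M ε R (.sum 0 :: ((List.range π.rounds).flatMap π.roundProg ++ clusterProg))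
      reg S fun _ S' => (∃ h f, Clustered N D R h f S') ∧
        10 * (∑ v with (S' v).flag ≠ 0, μ v) ≤ ∑ v, μ v := by
  refine .cons (Machine.achieves_sum hS hμ ?_)
  have hI : π.Invariant N D ε μ 0 (fun _ => []) Set.univ :=
    ⟨fun v => ⟨v, trivial, 0, .refl, by simp⟩, fun _ _ => rfl, ∅, fun _ _ _ _ h _ => h, by simp⟩
  refine .append ((π.achieves_rounds hO hS hI hπ hB hM hμ (by simp [hflag])).mono ?_)
  rintro reg S ⟨h, Q, hS, hI⟩
  refine (Machine.achieves_clusterProg hO hS hπ.pos hπ.eps_le hR hM (fun v => (hB v).trans hBM)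
    fun v => ?_).mono ?_
  · obtain ⟨q, hq, d, hd, hle⟩ := hI.near_le hπ le_rfl hB v
    refine ⟨q, hq, d, hd, ?_⟩
    have h1 := hπ.rad
    have h2 := (π.reach D).coe_nonneg
    rw [Pi.zero_apply, zero_add, ← NNReal.coe_le_coe, NNReal.coe_mul, NNReal.coe_ofNat]
    linarith
  · rintro - S' ⟨f, hf, hC⟩
    refine ⟨⟨_, f, hC⟩, ?_⟩
    obtain ⟨A, hA, hAw⟩ := hI.bad
    have hsub : ({v | (S' v).flag ≠ 0} : Finset V) ⊆ A := by
      intro v hv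
      by_contra hvA
      obtain ⟨u, d, hr, hd, hne⟩ := hC.bad v (by simpa using hv)
      have hr' := hA v hvA u d hr hd
      have hs := N.link_symm D h
      obtain ⟨q, d₁, hq, -⟩ := hC.rooted u
      obtain ⟨q', d₂, hq', -⟩ := hC.rooted v
      have e : h q = h q' := (((hq'.reach hf.parent).symm hs).trans
        (hr'.trans (hq.reach hf.parent))).invariant (fun _ _ h => h.2.2) |>.symm
      rw [hI.code q (hf.source u q d₁ hq), hI.code q' (hf.source v q' d₂ hq')] at e
      refine hne ?_
      rw [hC.hist u q d₁ hq, hC.hist v q' d₂ hq', hinj _ (hB q) _ (hB q') e,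
        hr'.invariant (φ := h) fun _ _ h => h.2.2]
    have h1 : ∑ v, μ v * (h v).sum ≤ π.depth * ∑ v, μ v := by
      rw [Finset.mul_sum]
      refine Finset.sum_le_sum fun v _ => ?_
      obtain ⟨q, -, -, -, e⟩ := hI.exists_code v
      rw [e, mul_comm]
      exact Nat.mul_le_mul_right _ (hπ.sum_le _ (hB q))
    have h2 : ∑ v with (S' v).flag ≠ 0, μ v ≤ ∑ v ∈ A, μ v := Finset.sum_le_sum_of_subset hsub
    -- Both terms in the weight bound are at most `rounds` times the total: histories sum to at most
    -- `depth`, and there are `depth * width` rounds.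
    have h3 : 2 * π.rounds * (10 * ∑ v ∈ A, μ v) ≤ 2 * π.rounds * ∑ v, μ v := by
      have h4 := Nat.mul_le_mul_left π.width h1
      simp only [rounds] at hAw ⊢
      nlinarith
    have h5 := Nat.le_of_mul_le_mul_left h3 (by omega)
    omega

end Run

/-! ## Separating identifiers by their digits -/

/-- Round `i * s + j` treats the identifiers with `i`-th digit `j` in base `s = 2 ^ k`. -/
def digitPlan (c k n : ℕ) : Plan where
  pred r x := x / (2 ^ k) ^ (r / 2 ^ k) % 2 ^ k = r % 2 ^ k
  depth := c * Nat.clog 2 n / k + 1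
  width := 2 ^ k
  -- `20 * depth` growth steps double the quantity in `exists_acceptable`, and `k + 1` doublings
  -- cover the factor `1 + 2 ^ k`.
  half := 20 * (c * Nat.clog 2 n / k + 1) * (k + 1)

namespace Plan

open Classical in
theorem code_sum (π : Plan) (r x : ℕ) :
    (π.code r x).sum = ∑ t ∈ Finset.range r, if π.pred t x then 1 else 0 := by
  induction r with
  | zero => rfl
  | succ r ih => rw [code, List.sum_cons, ih, Finset.sum_range_succ, add_comm]

theorem pred_iff_of_code_eq (π : Plan) {r x y : ℕ} (h : π.code r x = π.code r y) {t : ℕ}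
    (ht : t < r) : π.pred t x ↔ π.pred t y := by
  induction r with
  | zero => omega
  | succ r ih =>
    rw [code, code, List.cons.injEq] at h
    rcases Nat.lt_succ_iff_lt_or_eq.1 ht with ht | rfl
    · exact ih h.2 ht
    · have := h.1
      split_ifs at this <;> tauto

end Plan

/-- Two terms of the binomial expansion of `(x + 1) ^ x` equal `x ^ x`. -/
theorem two_mul_pow_self_le {x : ℕ} (hx : 0 < x) : 2 * x ^ x ≤ (x + 1) ^ x := by
  obtain ⟨y, rfl⟩ : ∃ y, x = y + 1 := ⟨x - 1, by omega⟩
  rw [add_pow (y + 1) 1 (y + 1), Finset.sum_range_succ, Finset.sum_range_succ]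
  simp only [one_pow, mul_one, Nat.choose_self, Nat.choose_succ_self_right, Nat.cast_id]
  have : (y + 1) ^ y * (y + 1) = (y + 1) ^ (y + 1) := (pow_succ _ _).symm
  omega

theorem eq_of_digits_eq {s : ℕ} (p : ℕ) {x y : ℕ} (hx : x < s ^ p) (hy : y < s ^ p)
    (h : ∀ i < p, x / s ^ i % s = y / s ^ i % s) : x = y := by
  induction p generalizing x y with
  | zero => simp at hx hy; omega
  | succ p ih =>
    have h0 := h 0 (by omega)
    simp only [pow_zero, Nat.div_one] at h0
    have : x / s = y / s := by
      refine ih (Nat.div_lt_of_lt_mul (by rwa [← pow_succ']))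
        (Nat.div_lt_of_lt_mul (by rwa [← pow_succ'])) fun i hi => ?_
      have := h (i + 1) (by omega)
      rwa [pow_succ', ← Nat.div_div_eq_div_mul, ← Nat.div_div_eq_div_mul] at this
    rw [← Nat.div_add_mod x s, ← Nat.div_add_mod y s, this, h0]

/-! ### Properties and constants of the digit scheme -/

section Digits

variable (c k n : ℕ)

/-- Among the `2 ^ k` rounds of one digit position, exactly one matches the digit of `x`. -/
theorem digitPlan_code_sum_le (x : ℕ) :
    ((digitPlan c k n).code (digitPlan c k n).rounds x).sum ≤ (digitPlan c k n).depth := by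
  have hs : 0 < 2 ^ k := by positivity
  suffices key : ∀ p, ∑ t ∈ Finset.range (2 ^ k * p),
      (if x / (2 ^ k) ^ (t / 2 ^ k) % 2 ^ k = t % 2 ^ k then 1 else 0) ≤ p by
    rw [Plan.code_sum, Plan.rounds]
    convert key (digitPlan c k n).depth
    · rfl
    · exact Iff.rfl
  intro p
  induction p with
  | zero => simp
  | succ p ih =>
    rw [mul_add, mul_one, Finset.sum_range_add]
    refine Nat.add_le_add ih ?_
    have : ∀ j ∈ Finset.range (2 ^ k), (if x / (2 ^ k) ^ ((2 ^ k * p + j) / 2 ^ k) % 2 ^ k =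
        (2 ^ k * p + j) % 2 ^ k then 1 else 0) = if x / (2 ^ k) ^ p % 2 ^ k = j then 1 else 0 := by
      intro j hj
      have hj := Finset.mem_range.1 hj
      rw [Nat.mul_add_div hs, Nat.div_eq_of_lt hj, Nat.mul_add_mod, Nat.mod_eq_of_lt hj, add_zero]
    rw [Finset.sum_congr rfl this, Finset.sum_ite_eq]
    split_ifs <;> simp

/-- The round belonging to a digit of `x` has a predicate true for `x`, hence for `y`; and `depth`
digits determine numbers up to `n ^ c`. -/
theorem digitPlan_injective (hk : 0 < k) {x y : ℕ} (hx : x ≤ n ^ c) (hy : y ≤ n ^ c)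
    (h : (digitPlan c k n).code (digitPlan c k n).rounds x =
      (digitPlan c k n).code (digitPlan c k n).rounds y) : x = y := by
  have hs : 0 < 2 ^ k := by positivity
  have hlt : n ^ c < (2 ^ k) ^ (digitPlan c k n).depth := by
    calc n ^ c ≤ (2 ^ Nat.clog 2 n) ^ c := Nat.pow_le_pow_left (Nat.le_pow_clog one_lt_two n) c
      _ = 2 ^ (c * Nat.clog 2 n) := by rw [← pow_mul, mul_comm]
      _ < 2 ^ (k * (c * Nat.clog 2 n / k + 1)) :=
        Nat.pow_lt_pow_right one_lt_two (Nat.lt_mul_div_succ _ hk)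
      _ = _ := by rw [← pow_mul]; rfl
  refine eq_of_digits_eq (s := 2 ^ k) (digitPlan c k n).depth (hx.trans_lt hlt) (hy.trans_lt hlt)
    fun i hi => ?_
  have hj : x / (2 ^ k) ^ i % 2 ^ k < 2 ^ k := Nat.mod_lt _ hs
  have ht : 2 ^ k * i + x / (2 ^ k) ^ i % 2 ^ k < (digitPlan c k n).rounds := by
    calc 2 ^ k * i + x / (2 ^ k) ^ i % 2 ^ k < 2 ^ k * (i + 1) := by rw [mul_add]; omega
      _ ≤ _ := Nat.mul_le_mul_left _ hi
  have := Plan.pred_iff_of_code_eq _ h ht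
  simp only [digitPlan, Nat.mul_add_div hs, Nat.div_eq_of_lt hj, Nat.mul_add_mod,
    Nat.mod_eq_of_lt hj, add_zero, true_iff] at this
  exact this.symm

theorem digitPlan_width_lt :
    (1 + (digitPlan c k n).width) * (20 * (digitPlan c k n).depth) ^ (digitPlan c k n).half ≤
      (20 * (digitPlan c k n).depth + 1) ^ (digitPlan c k n).half := by
  change (1 + 2 ^ k) * (20 * (digitPlan c k n).depth) ^ (20 * (digitPlan c k n).depth * (k + 1)) ≤
    (20 * (digitPlan c k n).depth + 1) ^ (20 * (digitPlan c k n).depth * (k + 1))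
  generalize hx : 20 * (digitPlan c k n).depth = x
  have hx : 2 * x ^ x ≤ (x + 1) ^ x :=
    two_mul_pow_self_le (hx ▸ Nat.mul_pos (by norm_num) (Nat.succ_pos _))
  calc (1 + 2 ^ k) * x ^ (x * (k + 1)) ≤ 2 ^ (k + 1) * x ^ (x * (k + 1)) := by
        gcongr
        have : 1 ≤ 2 ^ k := Nat.one_le_two_pow
        rw [pow_succ]
        omega
    _ = (2 * x ^ x) ^ (k + 1) := by rw [mul_pow, pow_mul]
    _ ≤ ((x + 1) ^ x) ^ (k + 1) := by gcongr
    _ = (x + 1) ^ (x * (k + 1)) := by rw [pow_mul]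

variable {c k n}

theorem clog_le_logb (hn : 1 ≤ n) : (Nat.clog 2 n : ℝ) ≤ Real.logb 2 n + 1 := by
  rw [← Real.natCeil_logb_natCast]
  refine (Nat.ceil_lt_add_one (Real.logb_nonneg (by norm_num) (by exact_mod_cast hn))).le

theorem one_le_logb (hn : 2 ≤ n) : 1 ≤ Real.logb 2 n := by
  rw [Real.le_logb_iff_rpow_le (by norm_num) (by positivity), Real.rpow_one]
  exact_mod_cast hn

theorem precision_le_one (hn : 2 ≤ n) : precision n ≤ 1 := by
  rw [← NNReal.coe_le_coe, coe_precision, NNReal.coe_one]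
  exact div_le_one_of_le₀ (one_le_pow₀ (one_le_logb hn)) (by positivity)

theorem two_le_of_large (hn : (2 : ℝ) ^ (k + 1) ≤ Real.logb 2 n) : 2 ≤ n := by
  by_contra hlt
  have : Real.logb 2 n ≤ 0 := by
    rcases (by omega : n = 0 ∨ n = 1) with rfl | rfl <;> simp
  have : (0 : ℝ) < 2 ^ (k + 1) := by positivity
  linarith

variable (hk : 12800 * (c + 1) ^ 2 ≤ k) (hn : (2 : ℝ) ^ (k + 1) ≤ Real.logb 2 n)

include hk hn

theorem digitPlan_depth_le :
    (k : ℝ) * (digitPlan c k n).depth ≤ 2 * (c + 1) * Real.logb 2 n ∧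
      ((digitPlan c k n).depth : ℝ) ≤ Real.logb 2 n := by
  have h2 := two_le_of_large hn
  have hl := one_le_logb h2
  have hkpos : 0 < k := lt_of_lt_of_le (by positivity) hk
  have hkl : (k : ℝ) ≤ Real.logb 2 n := by
    refine le_trans ?_ hn
    exact_mod_cast ((Nat.lt_two_pow_self (n := k)).le.trans
      (Nat.pow_le_pow_right (by norm_num) (Nat.le_succ k)))
  have h1 : (k : ℝ) * (digitPlan c k n).depth ≤ 2 * (c + 1) * Real.logb 2 n := by
    have h3 : k * (digitPlan c k n).depth ≤ c * Nat.clog 2 n + k := by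
      change k * (c * Nat.clog 2 n / k + 1) ≤ _
      rw [mul_add, mul_one]
      exact Nat.add_le_add_right (Nat.mul_div_le _ _) _
    have h4 : (k : ℝ) * (digitPlan c k n).depth ≤ c * Nat.clog 2 n + k := by exact_mod_cast h3
    have h5 := clog_le_logb (n := n) (by omega)
    have h6 : (c : ℝ) * Nat.clog 2 n ≤ c * (2 * Real.logb 2 n) := by gcongr; linarith
    nlinarith
  refine ⟨h1, ?_⟩
  have h7 : (2 * (c + 1) : ℝ) ≤ k := by exact_mod_cast (by nlinarith : 2 * (c + 1) ≤ k)
  have h8 : (k : ℝ) * (digitPlan c k n).depth ≤ k * Real.logb 2 n := h1.trans (by gcongr)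
  exact le_of_mul_le_mul_left h8 (by exact_mod_cast hkpos)

/-- With `L = log n`, the at most `L ^ 2 / 2` rounds inflate distances by at most `exp (1 / 2)`;
this needs `n` large in terms of `k`. The error of one comparison is governed by `3200 * p ^ 2 * k /
L ^ 2 ≤ 12800 * (c + 1) ^ 2 / k`, whence the bound on `k`. The constant 8000 is `4 * 2 * 20 * 50`.
-/
theorem digitPlan_fits {D R : ℝ≥0} (hD : 0 < D)
    (hR : 8000 * (1 + (digitPlan c k n).depth) * (digitPlan c k n).depth * (k + 1) * D ≤ R) :
    (digitPlan c k n).Fits (precision n) D R (n ^ c) := by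
  obtain ⟨h1, h2⟩ := digitPlan_depth_le hk hn
  have hn2 := two_le_of_large hn
  have hl := one_le_logb hn2
  have hkpos : 0 < k := lt_of_lt_of_le (by positivity) hk
  have hp1 : 1 ≤ (digitPlan c k n).depth := Nat.le_add_left _ _
  have hhalf : (digitPlan c k n).half = 20 * (digitPlan c k n).depth * (k + 1) := rfl
  set p := (digitPlan c k n).depth
  set L := Real.logb 2 n
  have hp1' : (1 : ℝ) ≤ p := by exact_mod_cast hp1
  have hk1 : (1 : ℝ) ≤ k := by exact_mod_cast hkpos
  refine ⟨hD, ?_, precision_le_one hn2, ?_, ?_, ?_, fun x _ => digitPlan_code_sum_le c k n x,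
    digitPlan_width_lt c k n⟩
  · rw [hhalf]
    nlinarith [Nat.zero_le (p * k)]
  · have hN : ((digitPlan c k n).rounds : ℝ) * precision n ≤ 1 / 2 := by
      have : ((digitPlan c k n).rounds : ℝ) = 2 ^ k * p := by
        simp [Plan.rounds, p, digitPlan]
      rw [this, coe_precision, mul_one_div, div_le_iff₀ (by positivity)]
      rw [pow_succ] at hn
      calc (2 : ℝ) ^ k * p ≤ (L / 2) * L := by gcongr; linarith
        _ = 1 / 2 * L ^ 2 := by ring
    have h3 : (1 + precision n : ℝ) ≤ Real.exp (precision n) := by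
      rw [add_comm]; exact Real.add_one_le_exp _
    calc (1 + precision n : ℝ) ^ (digitPlan c k n).rounds
        ≤ Real.exp (precision n) ^ (digitPlan c k n).rounds := by gcongr
      _ = Real.exp ((digitPlan c k n).rounds * precision n) := (Real.exp_nat_mul _ _).symm
      _ ≤ Real.exp (1 / 2) := by gcongr
      _ ≤ 2 := by
        have h4 : Real.exp (1 / 2) ^ 2 = Real.exp 1 := by
          rw [← Real.exp_nat_mul]; norm_num
        have h5 := Real.exp_one_lt_d9
        nlinarith [Real.exp_pos (1 / 2)]
  · rw [coe_precision, hhalf]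
    have e : 40 * (1 / L ^ 2) * (1 + (p : ℝ)) * ((20 * p * (k + 1) : ℕ) : ℝ) =
        800 * (1 + p) * p * (k + 1) / L ^ 2 := by push_cast; ring
    rw [e, div_le_one (by positivity)]
    have hk' : (12800 * (c + 1) ^ 2 : ℝ) ≤ k := by exact_mod_cast hk
    have h3 : ((k : ℝ) * p) ^ 2 ≤ (2 * (c + 1) * L) ^ 2 := by gcongr
    have h4 : (k : ℝ) * (800 * (1 + p) * p * (k + 1)) ≤ k * L ^ 2 := calc
      (k : ℝ) * (800 * (1 + p) * p * (k + 1)) ≤ k * (800 * (p + p) * p * (k + k)) := by gcongr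
      _ = 3200 * p * ((k * p) * k) := by ring
      _ = 3200 * (k * p) ^ 2 := by ring
      _ ≤ 3200 * (2 * (c + 1) * L) ^ 2 := by gcongr
      _ = (12800 * (c + 1) ^ 2) * L ^ 2 := by ring
      _ ≤ k * L ^ 2 := by gcongr
    exact le_of_mul_le_mul_left h4 (by linarith)
  · rw [← NNReal.coe_le_coe] at hR
    refine le_trans (le_of_eq ?_) hR
    simp only [Plan.reach, hhalf]
    push_cast
    ring

end Digits

/-! ## The deterministic algorithm -/

theorem exists_forall_le_logb (x : ℝ) : ∃ n₀ : ℕ, ∀ n ≥ n₀, x ≤ Real.logb 2 n :=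
  Filter.eventually_atTop.1 (((Real.tendsto_logb_atTop one_lt_two).comp
    tendsto_natCast_atTop_atTop).eventually_ge_atTop x)

/-- The delays for networks with few nodes: the source with the least identifier prevails. -/
def smallDelay (i : LocalInput) : ℝ≥0 := 3 ^ (i.ident + 1) * (12 * i.n * i.D)

/-- The distance parameter for networks with few nodes. -/
def smallRadius (c n : ℕ) : ℕ := 2 * 3 ^ (n ^ c + 1) * 12 * n + 10

theorem smallRadius_mono (c : ℕ) : Monotone (smallRadius c) := fun a b h => by
  unfold smallRadius
  gcongr
  norm_num

def deterministicMachine (c k n₀ : ℕ) : Machine fun _ => ℕ where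
  prog n := if n < n₀ then clusterProg else
    .sum 0 :: ((List.range (digitPlan c k n).rounds).flatMap (digitPlan c k n).roundProg ++
      clusterProg)
  rad n D := if n < n₀ then smallRadius c n * D else
    8000 * (1 + (digitPlan c k n).depth) * (digitPlan c k n).depth * (k + 1) * D
  weight _ x := x
  delay i _ := if i.n < n₀ then smallDelay i else 0

section Run

variable {V : Type} [Fintype V] {N : Network V} {X : ℕ → Type} {O : Oracle N} {D : ℝ≥0} {K : ℕ}

theorem one_le_logCard (hn : 2 ≤ Fintype.card V) : 1 ≤ logCard V := one_le_logb hn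

theorem length_le_timeLimit {l : ℕ} (hn : 2 ≤ Fintype.card V) (hl : l ≤ K) :
    l ≤ timeLimit V K := by
  refine Nat.le_floor ?_
  have h1 : (1 : ℝ) ≤ logCard V ^ 3 := one_le_pow₀ (one_le_logCard hn)
  have h2 : (l : ℝ) ≤ K := by exact_mod_cast hl
  nlinarith [Nat.cast_nonneg (α := ℝ) K]

theorem radius_le {ρ : ℕ} (hn : 2 ≤ Fintype.card V) (hρ : 2 * ρ ≤ K) :
    2 * (((ρ * D : ℝ≥0)) : ℝ) ≤ K * logCard V ^ 3 * D := by
  have h1 : (1 : ℝ) ≤ logCard V ^ 3 := one_le_pow₀ (one_le_logCard hn)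
  have h2 : (2 * ρ : ℝ) ≤ K := by exact_mod_cast hρ
  have h3 : (2 * ρ : ℝ) ≤ K * logCard V ^ 3 := by nlinarith [Nat.cast_nonneg (α := ℝ) K]
  rw [NNReal.coe_mul, NNReal.coe_natCast, ← mul_assoc]
  gcongr

/-- A machine that only forms clusters, with the delays for networks with few nodes. -/
theorem Machine.computesPadded_small {m : Machine X} {x : V → X (Fintype.card V)} {c n₀ : ℕ}
    (hO : IsDistOracle N O) (hn : 2 ≤ Fintype.card V) (hid : ∀ v, N.ident v ≤ Fintype.card V ^ c)
    (hD : 0 < D) (hn₀ : Fintype.card V ≤ n₀) (hK : c + 5 + 2 * smallRadius c n₀ ≤ K)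
    (hprog : m.prog (Fintype.card V) = clusterProg)
    (hrad : m.rad (Fintype.card V) D = smallRadius c (Fintype.card V) * D)
    (hdelay : ∀ v, m.delay (localInput N D v) (x v) = smallDelay (localInput N D v)) :
    ComputesPadded N m.alg O D x K ∧ outBad N m.alg O D x K = ∅ := by
  have hmono := smallRadius_mono c hn₀
  obtain ⟨h1, S, hS, e⟩ := Machine.computesPadded (m := m) (N := N) (O := O) (x := x) (K := K)
    (Post := fun S => ∀ v, (S v).flag = 0) hD
    (by rw [hprog]; exact length_le_timeLimit hn (by change 5 ≤ K; omega))
    (by rw [hrad]; exact radius_le hn (by omega))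
    (by
      have hrep := represents_init (N := N) m D x
      simp only [hdelay] at hrep
      rw [hprog]
      exact Machine.achieves_components (B := Fintype.card V ^ c) hO hrep hD (precision_le_one hn)
        hid (Nat.one_le_pow _ _ (by omega)) (Nat.pow_le_pow_right (by omega) (by omega))
        (by rw [hrad, smallRadius]; push_cast; exact le_rfl))
  exact ⟨h1, by rw [e]; exact Set.eq_empty_iff_forall_notMem.2 fun v hv => hv (hS v)⟩

theorem deterministic_time_le {c k : ℕ} (hk : 12800 * (c + 1) ^ 2 ≤ k)
    (hn : (2 : ℝ) ^ (k + 1) ≤ logCard V)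
    (hK : 2 ^ k * (120 * (k + 1) + 6) + 6 ≤ K) :
    (digitPlan c k (Fintype.card V)).rounds * (6 * (digitPlan c k (Fintype.card V)).half + 6) + 6
      ≤ timeLimit V K := by
  obtain ⟨-, h2⟩ := digitPlan_depth_le hk hn
  have hl := one_le_logb (two_le_of_large hn)
  refine Nat.le_floor ?_
  change _ ≤ (K : ℝ) * Real.logb 2 (Fintype.card V) ^ 3
  have e1 : ((digitPlan c k (Fintype.card V)).rounds : ℝ) =
      2 ^ k * (digitPlan c k (Fintype.card V)).depth := by
    simp [Plan.rounds, digitPlan]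
  have e2 : ((digitPlan c k (Fintype.card V)).half : ℝ) =
      20 * (digitPlan c k (Fintype.card V)).depth * (k + 1) := by
    simp [digitPlan]
  push_cast
  rw [e1, e2]
  have hK' : (2 ^ k * (120 * (k + 1) + 6) + 6 : ℝ) ≤ K := by exact_mod_cast hK
  have hp : (0 : ℝ) ≤ (digitPlan c k (Fintype.card V)).depth := Nat.cast_nonneg _
  generalize ((digitPlan c k (Fintype.card V)).depth : ℝ) = p at *
  generalize Real.logb 2 (Fintype.card V) = L at *
  have hL1 : (1 : ℝ) ≤ L ^ 3 := one_le_pow₀ hl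
  calc (2 : ℝ) ^ k * p * (6 * (20 * p * (k + 1)) + 6) + 6
      ≤ 2 ^ k * L * (6 * (20 * L * (k + 1)) + 6 * L) + 6 * L ^ 3 := by
        gcongr
        · linarith
        · linarith
    _ = 2 ^ k * (120 * (k + 1) + 6) * L ^ 2 * 1 + 6 * L ^ 3 := by ring
    _ ≤ 2 ^ k * (120 * (k + 1) + 6) * L ^ 2 * L + 6 * L ^ 3 := by gcongr
    _ = (2 ^ k * (120 * (k + 1) + 6) + 6) * L ^ 3 := by ring
    _ ≤ K * L ^ 3 := by gcongr

theorem deterministic_radius_le {c k : ℕ} (hk : 12800 * (c + 1) ^ 2 ≤ k)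
    (hn : (2 : ℝ) ^ (k + 1) ≤ logCard V) (hK : 32000 * (k + 1) ≤ K) :
    2 * (((8000 * (1 + (digitPlan c k (Fintype.card V)).depth) *
      (digitPlan c k (Fintype.card V)).depth * (k + 1) * D : ℝ≥0)) : ℝ) ≤
        K * logCard V ^ 3 * D := by
  obtain ⟨-, h2⟩ := digitPlan_depth_le hk hn
  have hl := one_le_logb (two_le_of_large hn)
  have h1 : (1 : ℝ) ≤ (digitPlan c k (Fintype.card V)).depth := by
    exact_mod_cast Nat.le_add_left 1 _
  have hK' : (32000 * (k + 1) : ℝ) ≤ K := by exact_mod_cast hK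
  push_cast
  rw [logCard]
  generalize ((digitPlan c k (Fintype.card V)).depth : ℝ) = p at *
  generalize Real.logb 2 (Fintype.card V) = L at *
  rw [← mul_assoc]
  refine mul_le_mul_of_nonneg_right ?_ D.coe_nonneg
  calc 2 * (8000 * (1 + p) * p * ((k : ℝ) + 1)) ≤ 2 * (8000 * (L + L) * L * (k + 1)) := by gcongr
    _ = 32000 * (k + 1) * L ^ 2 * 1 := by ring
    _ ≤ 32000 * (k + 1) * L ^ 2 * L := by gcongr
    _ = 32000 * (k + 1) * L ^ 3 := by ring
    _ ≤ K * L ^ 3 := by gcongr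

end Run

-- Valid for all large `K`, so that both algorithms can share one constant. As `k` and `n₀` depend
-- only on `c`, the networks with `n < n₀` cost a constant.
open Classical in
theorem exists_deterministic (c : ℕ) : ∃ (K₀ : ℕ) (A : Alg fun _ => ℕ), ∀ K ≥ K₀,
    ∀ (V : Type) [Fintype V] (N : Network V), 2 ≤ Fintype.card V →
      (∀ v, N.ident v ≤ Fintype.card V ^ c) → ∀ O : Oracle N, IsDistOracle N O →
      ∀ D : ℝ≥0, 0 < D → ∀ μ : V → ℕ, (∀ v, μ v ≤ Fintype.card V ^ c) →
        ComputesPadded N A O D μ K ∧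
        ∑ v with v ∈ outBad N A O D μ K, (μ v : ℝ) ≤ 1 / 10 * ∑ v, (μ v : ℝ) := by
  obtain ⟨k, hk⟩ : ∃ k, 12800 * (c + 1) ^ 2 ≤ k := ⟨_, le_rfl⟩
  obtain ⟨n₀, hn₀⟩ := exists_forall_le_logb (2 ^ (k + 1))
  refine ⟨(c + 5 + 2 * smallRadius c n₀) + (2 ^ k * (120 * (k + 1) + 6) + 6) + 32000 * (k + 1),
    (deterministicMachine c k n₀).alg, fun K hK V _ N hn hid O hO D hD μ hμ => ?_⟩
  rcases lt_or_ge (Fintype.card V) n₀ with hlt | hge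
  · obtain ⟨h1, h2⟩ := Machine.computesPadded_small (m := deterministicMachine c k n₀) (x := μ)
      (c := c) (K := K) hO hn hid hD hlt.le (by omega)
      (by simp [deterministicMachine, hlt]) (by simp [deterministicMachine, hlt])
      fun v => by simp [deterministicMachine, localInput, hlt]
    refine ⟨h1, ?_⟩
    rw [h2]
    simp only [Set.mem_empty_iff_false, Finset.filter_false, Finset.sum_empty]
    positivity
  · have hL := hn₀ _ hge
    have hkpos : 0 < k := lt_of_lt_of_le (by positivity) hk
    have hprog : (deterministicMachine c k n₀).prog (Fintype.card V) = _ := if_neg (not_lt.2 hge)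
    have hrad : (deterministicMachine c k n₀).rad (Fintype.card V) D = _ := if_neg (not_lt.2 hge)
    have hp1 : 1 ≤ (digitPlan c k (Fintype.card V)).depth := Nat.le_add_left _ _
    have hlen : ((deterministicMachine c k n₀).prog (Fintype.card V)).length ≤ timeLimit V K := by
      rw [hprog]
      refine le_trans (le_of_eq ?_) (deterministic_time_le hk hL (by omega))
      simp [List.length_flatMap, Plan.length_roundProg, clusterProg]
    obtain ⟨h1, S, hS, e⟩ := Machine.computesPadded (m := deterministicMachine c k n₀) (x := μ)
      (O := O) (K := K) (Post := fun S => 10 * (∑ v with (S v).flag ≠ 0, μ v) ≤ ∑ v, μ v) hD hlen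
      (by rw [hrad]; exact deterministic_radius_le hk hL (le_trans (Nat.le_add_left _ _) hK))
      (by
        have hrep := represents_init (N := N) (deterministicMachine c k n₀) D μ
        have hδ : (fun v => (deterministicMachine c k n₀).delay (localInput N D v) (μ v)) = 0 :=
          funext fun v => if_neg (not_lt.2 hge)
        rw [hδ] at hrep
        rw [hprog, hrad]
        refine Plan.achieves_partition (B := Fintype.card V ^ c) hO hrep (fun _ => rfl)
          (digitPlan_fits hk hL hD le_rfl) ?_ hid
          (fun x hx y hy h => digitPlan_injective c k _ hkpos hx hy h)
          (Nat.mul_pos (by simp [digitPlan]) hp1)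
          (Nat.one_le_pow _ _ (by omega)) (Nat.pow_le_pow_right (by omega) (by omega))
          fun v => (hμ v).trans (Nat.pow_le_pow_right (by omega) (by omega))
        gcongr
        have : 10 ≤ 8000 * (1 + (digitPlan c k (Fintype.card V)).depth) *
            (digitPlan c k (Fintype.card V)).depth * (k + 1) := by
          have := Nat.mul_le_mul (Nat.mul_le_mul (Nat.mul_le_mul_left 8000
            (Nat.le_add_right 1 (digitPlan c k (Fintype.card V)).depth)) hp1)
            (Nat.le_add_left 1 k)
          omega
        exact_mod_cast this)
    refine ⟨h1, ?_⟩
    rw [e]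
    have hS' : (10 : ℝ) * (∑ v with (S v).flag ≠ 0, (μ v : ℝ)) ≤ ∑ v, (μ v : ℝ) := by
      exact_mod_cast hS
    simp only [Set.mem_ofPred_eq]
    linarith

/-! ## Shifts with a truncated geometric distribution -/

-- The `5 * T` bits encode a uniform number below `32 ^ T`. Letting `k ≤ γ` when it is below `31 ^ k
-- * 32 ^ (T - k)` gives the exact tail `(31 / 32) ^ k`, hence memorylessness below the cap `T`.
open Classical in
theorem exists_geometric (T : ℕ) : ∃ γ : (Fin (5 * T) → Bool) → ℕ, (∀ y, γ y ≤ T) ∧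
    (∀ k < T, 32 * Fintype.card {y // γ y = k} ≤ Fintype.card {y // k ≤ γ y}) ∧
    Fintype.card {y // γ y = T} ≤ 31 ^ T := by
  have hcard : Fintype.card (Fin (5 * T) → Bool) = 32 ^ T := by
    rw [Fintype.card_fun, Fintype.card_bool, Fintype.card_fin, pow_mul]
    norm_num
  let e : (Fin (5 * T) → Bool) ≃ Fin (32 ^ T) := Fintype.equivFinOfCardEq hcard
  let b : ℕ → ℕ := fun k => 31 ^ k * 32 ^ (T - k)
  have hb : ∀ k < T, 32 * b (k + 1) = 31 * b k := by
    intro k hk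
    simp only [b, show T - k = T - (k + 1) + 1 by omega, pow_succ]
    ring
  have hanti : ∀ k ≤ T, ∀ j ≤ k, b k ≤ b j := by
    intro k hk j hj
    induction k, hj using Nat.le_induction with
    | base => exact le_rfl
    | succ k _ ih =>
      have := hb k (by omega)
      have := ih (by omega)
      omega
  let γ : (Fin (5 * T) → Bool) → ℕ := fun y => Nat.findGreatest (fun k => (e y : ℕ) < b k) T
  have hγ : ∀ y, ∀ k ≤ T, k ≤ γ y ↔ (e y : ℕ) < b k := by
    intro y k hk
    constructor
    · intro h
      have h0 : (e y : ℕ) < b 0 := by simp [b]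
      have := Nat.findGreatest_spec (P := fun k => (e y : ℕ) < b k) (Nat.zero_le T) h0
      exact this.trans_le (hanti _ (Nat.findGreatest_le T) k h)
    · exact fun h => Nat.le_findGreatest hk h
  have hge : ∀ k ≤ T, Fintype.card {y // k ≤ γ y} = b k := by
    intro k hk
    have hle : b k ≤ 32 ^ T := by simpa [b] using hanti k hk 0 (Nat.zero_le k)
    rw [Fintype.card_congr ((e.subtypeEquiv fun y => hγ y k hk).trans
      (Fin.castLEquiv hle).symm), Fintype.card_fin]
  have hlast : b T = 31 ^ T := by simp [b]
  refine ⟨γ, fun y => Nat.findGreatest_le T, fun k hk => ?_, ?_⟩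
  · have h1 : Fintype.card {y // k ≤ γ y} =
        Fintype.card {y // γ y = k} + Fintype.card {y // k + 1 ≤ γ y} := by
      rw [← Fintype.card_subtype_or_disjoint _ _ (Pi.disjoint_iff.2 fun y =>
        Prop.disjoint_iff.2 (by omega))]
      exact Fintype.card_congr (Equiv.subtypeEquivRight fun y => by omega)
    rw [hge k hk.le, hge (k + 1) hk] at h1
    have := hb k hk
    rw [hge k hk.le]
    omega
  · rw [← hlast, ← hge T le_rfl]
    exact Fintype.card_subtype_mono _ _ fun y hy => hy.ge

/-- The number of pairs with a property that is insensitive to the coordinate `u`. -/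
theorem card_update {V Y : Type} [Fintype V] [DecidableEq V] [Fintype Y] (u : V)
    (P : (V → Y) → Y → Prop) [∀ ω, DecidablePred (P ω)] [DecidablePred fun ω => P ω (ω u)]
    (hP : ∀ ω y y', P (Function.update ω u y) y' ↔ P ω y') :
    Fintype.card Y * Fintype.card {ω // P ω (ω u)} = ∑ ω, Fintype.card {y // P ω y} := by
  classical
  rw [← Fintype.card_sigma, ← Fintype.card_congr (Equiv.subtypeProdEquivSigmaSubtype P), mul_comm,
    ← Fintype.card_prod]
  -- The bijection swaps coordinate `u` with the extra sample, to which `P ω` is insensitive.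
  refine Fintype.card_congr
    { toFun := fun p => ⟨(Function.update p.1.1 u p.2, p.1.1 u), (hP _ _ _).2 p.1.2⟩
      invFun := fun p => (⟨Function.update p.1.1 u p.1.2, by
        rw [hP, Function.update_self]; exact p.2⟩, p.1.1 u)
      left_inv := ?_
      right_inv := ?_ }
  · rintro ⟨⟨ω, h⟩, y⟩
    simp
  · rintro ⟨⟨ω, y⟩, h⟩
    simp

/-! ### The probability that no source leads clearly -/

section Lead

variable {V Y : Type} [Fintype V] (a : V → ℝ) (γ : Y → ℕ)

/-- With shift `k`, the node `u` beats all others; ties are broken by identifiers. -/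
def Beats (tag : V ↪ ℕ) (u : V) (k : ℕ) (ω : V → Y) : Prop :=
  ∀ u' ≠ u, γ (ω u') + a u' < k + a u ∨ γ (ω u') + a u' = k + a u ∧ tag u < tag u'

/-- Some node leads by at least one. -/
def HasLeader (ω : V → Y) : Prop := ∃ u, ∀ u' ≠ u, γ (ω u') + a u' + 1 ≤ γ (ω u) + a u

-- Fix all shifts except that of `u`. If `u` is on top but not ahead by one, its shift is the least
-- `k` that beats the others; below the cap this has at most `1 / 32` of the probability that `u`
-- wins. The winning events are disjoint, so these sum to at most `1 / 32`. The cap contributes `1 /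
-- (32 n)` per node, again `1 / 32` in all.
open Classical in
theorem card_not_hasLeader (tag : V ↪ ℕ) [Nonempty V] [Fintype Y] [Nonempty Y] {T : ℕ}
    (h₀ : ∀ y, γ y ≤ T)
    (h₁ : ∀ k < T, 32 * Fintype.card {y // γ y = k} ≤ Fintype.card {y // k ≤ γ y})
    (h₂ : 32 * Fintype.card V * Fintype.card {y // γ y = T} ≤ Fintype.card Y) :
    16 * Fintype.card {ω : V → Y // ¬ HasLeader a γ ω} ≤ Fintype.card (V → Y) := by
  set n := Fintype.card V with hn
  have hnpos : 0 < n := Fintype.card_pos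
  have hmono : ∀ u k k' ω, k ≤ k' → Beats a γ tag u k ω → Beats a γ tag u k' ω := by
    intro u k k' ω hk h u' hu'
    rcases hk.lt_or_eq with hk | rfl
    · have hk : (k : ℝ) < k' := by exact_mod_cast hk
      left
      rcases h u' hu' with h | h <;> linarith [h]
    · exact h u' hu'
  have hupd : ∀ u k ω y, Beats a γ tag u k (Function.update ω u y) ↔ Beats a γ tag u k ω := by
    intro u k ω y
    refine forall_congr' fun u' => forall_congr' fun hu' => ?_
    rw [Function.update_of_ne hu']
  let PE : V → (V → Y) → Y → Prop := fun u ω y =>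
    Beats a γ tag u (γ y) ω ∧ ∀ k < γ y, ¬ Beats a γ tag u k ω
  let PT : V → (V → Y) → Y → Prop := fun u ω y => Beats a γ tag u (γ y) ω
  have hfib : ∀ u ω, 32 * n * Fintype.card {y // PE u ω y} ≤
      n * Fintype.card {y // PT u ω y} + Fintype.card Y := by
    intro u ω
    by_cases hex : ∃ k, Beats a γ tag u k ω
    · let k₀ := Nat.find hex
      have hPE : ∀ y, PE u ω y → γ y = k₀ := fun y hy =>
        le_antisymm (not_lt.1 fun h => hy.2 _ h (Nat.find_spec hex)) (Nat.find_min' hex hy.1)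
      rcases lt_or_ge k₀ T with hlt | hge
      · have e1 : Fintype.card {y // PE u ω y} ≤ Fintype.card {y // γ y = k₀} :=
          Fintype.card_subtype_mono _ _ hPE
        have e2 : Fintype.card {y // k₀ ≤ γ y} ≤ Fintype.card {y // PT u ω y} :=
          Fintype.card_subtype_mono _ _ fun y hy => hmono _ _ _ _ hy (Nat.find_spec hex)
        have e3 := h₁ k₀ hlt
        calc 32 * n * Fintype.card {y // PE u ω y} = n * (32 * Fintype.card {y // PE u ω y}) := by
              ring
          _ ≤ n * Fintype.card {y // PT u ω y} := by
              gcongr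
              omega
          _ ≤ _ := Nat.le_add_right _ _
      · have e1 : Fintype.card {y // PE u ω y} ≤ Fintype.card {y // γ y = T} :=
          Fintype.card_subtype_mono _ _ fun y hy =>
            le_antisymm (h₀ y) (hge.trans (hPE y hy).ge)
        calc 32 * n * Fintype.card {y // PE u ω y} ≤ 32 * n * Fintype.card {y // γ y = T} := by
              gcongr
          _ ≤ Fintype.card Y := h₂
          _ ≤ _ := Nat.le_add_left _ _
    · have : IsEmpty {y // PE u ω y} := ⟨fun y => hex ⟨_, y.2.1⟩⟩
      simp
  have hE : ∀ u, 32 * n * Fintype.card {ω : V → Y // PE u ω (ω u)} ≤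
      n * Fintype.card {ω : V → Y // PT u ω (ω u)} + Fintype.card (V → Y) := by
    intro u
    have e1 := card_update u (PE u) fun ω y y' => by simp only [PE, hupd]
    have e2 := card_update u (PT u) fun ω y y' => by simp only [PT, hupd]
    refine le_of_mul_le_mul_left ?_ (Fintype.card_pos (α := Y))
    calc Fintype.card Y * (32 * n * Fintype.card {ω : V → Y // PE u ω (ω u)})
        = 32 * n * (Fintype.card Y * Fintype.card {ω : V → Y // PE u ω (ω u)}) := by ring
      _ = ∑ ω, 32 * n * Fintype.card {y // PE u ω y} := by rw [e1, Finset.mul_sum]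
      _ ≤ ∑ ω : V → Y, (n * Fintype.card {y // PT u ω y} + Fintype.card Y) :=
        Finset.sum_le_sum fun ω _ => hfib u ω
      _ = n * (Fintype.card Y * Fintype.card {ω : V → Y // PT u ω (ω u)}) +
          Fintype.card (V → Y) * Fintype.card Y := by
        rw [Finset.sum_add_distrib, ← Finset.mul_sum, e2, Finset.sum_const, smul_eq_mul,
          Finset.card_univ]
      _ = _ := by ring
  have hTop : ∑ u, Fintype.card {ω : V → Y // PT u ω (ω u)} ≤ Fintype.card (V → Y) := by
    rw [← Fintype.card_sigma]
    refine Fintype.card_le_of_injective (fun p => p.2.1) ?_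
    rintro ⟨u, ω, h⟩ ⟨u', ω', h'⟩ e
    obtain rfl : ω = ω' := e
    obtain rfl : u = u' := by
      by_contra hne
      have h1 := h u' (Ne.symm hne)
      have h2 := h' u hne
      rcases h1 with h1 | h1 <;> rcases h2 with h2 | h2
      · linarith
      · linarith [h2.1]
      · linarith [h1.1]
      · omega
    rfl
  have hBad : Fintype.card {ω : V → Y // ¬ HasLeader a γ ω} ≤
      ∑ u, Fintype.card {ω : V → Y // PE u ω (ω u)} := by
    rw [← Fintype.card_sigma]
    have key : ∀ ω : V → Y, ¬ HasLeader a γ ω → ∃ u, PE u ω (ω u) := by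
      intro ω hω
      obtain ⟨u, -, hu⟩ := Finset.exists_max_image (Finset.univ : Finset V)
        (fun u => toLex ((γ (ω u) + a u : ℝ), OrderDual.toDual (tag u))) Finset.univ_nonempty
      have hu : ∀ u' ≠ u, γ (ω u') + a u' < γ (ω u) + a u ∨
          γ (ω u') + a u' = γ (ω u) + a u ∧ tag u < tag u' := by
        intro u' hne
        rcases Prod.Lex.le_iff.1 (hu u' (Finset.mem_univ _)) with h | ⟨h, h'⟩
        · exact Or.inl h
        · exact Or.inr ⟨h, lt_of_le_of_ne h' fun e => hne (tag.injective e.symm)⟩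
      refine ⟨u, hu, fun k hk hkb => hω ⟨u, fun u' hne => ?_⟩⟩
      have hk' : (k : ℝ) + 1 ≤ γ (ω u) := by exact_mod_cast hk
      rcases hkb u' hne with h | h
      · linarith
      · linarith [h.1]
    choose! w hw using key
    exact Fintype.card_le_of_injective
      (fun ω : {ω : V → Y // ¬ HasLeader a γ ω} =>
        (⟨w ω, ω, hw ω ω.2⟩ : Σ u, {ω : V → Y // PE u ω (ω u)}))
      fun ω ω' e => Subtype.ext (congrArg (fun p => p.2.1) e)
  have hsum := Finset.sum_le_sum fun u (_ : u ∈ Finset.univ) => hE u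
  rw [← Finset.mul_sum, Finset.sum_add_distrib, ← Finset.mul_sum, Finset.sum_const,
    Finset.card_univ, smul_eq_mul, ← hn] at hsum
  have h3 : n * (32 * ∑ u, Fintype.card {ω : V → Y // PE u ω (ω u)}) ≤
      n * (2 * Fintype.card (V → Y)) := by
    calc n * (32 * ∑ u, Fintype.card {ω : V → Y // PE u ω (ω u)})
        = 32 * n * ∑ u, Fintype.card {ω : V → Y // PE u ω (ω u)} := by ring
      _ ≤ _ := hsum
      _ ≤ n * Fintype.card (V → Y) + n * Fintype.card (V → Y) := by gcongr
      _ = _ := by ring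
  have h4 := Nat.le_of_mul_le_mul_left h3 hnpos
  omega

end Lead

/-! ## The randomized algorithm -/

/-- The largest shift. -/
def maxShift (n : ℕ) : ℕ := 32 * (Nat.clog 2 n + 5)

/-- The shift computed from the random bits. -/
def shift (n : ℕ) : (Fin (5 * maxShift n) → Bool) → ℕ := (exists_geometric (maxShift n)).choose

/-- Every 32 units at least halve the tail, so `clog 2 n + 5` halvings bring it down to `1 / (32
n)`. -/
theorem maxShift_tail (n : ℕ) : 32 * n * 31 ^ maxShift n ≤ 32 ^ maxShift n := by
  have h1 : 2 * 31 ^ 32 ≤ 32 ^ 32 := by norm_num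
  calc 32 * n * 31 ^ maxShift n ≤ 32 * 2 ^ Nat.clog 2 n * 31 ^ maxShift n := by
        gcongr
        exact Nat.le_pow_clog one_lt_two n
    _ = (2 * 31 ^ 32) ^ (Nat.clog 2 n + 5) := by
        rw [mul_pow, ← pow_mul, maxShift, pow_add 2]
        ring
    _ ≤ (32 ^ 32) ^ (Nat.clog 2 n + 5) := Nat.pow_le_pow_left h1 _
    _ = 32 ^ maxShift n := by rw [← pow_mul, maxShift]

theorem maxShift_le {n : ℕ} (hn : 2 ≤ n) : (maxShift n : ℝ) ≤ 224 * Real.logb 2 n := by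
  have h1 := clog_le_logb (n := n) (by omega)
  have h2 := one_le_logb hn
  rw [maxShift]
  push_cast
  linarith

theorem precision_mul_maxShift_le {n : ℕ} (hn : 896 ≤ Real.logb 2 n) (hn2 : 2 ≤ n) :
    (precision n : ℝ) * maxShift n ≤ 1 / 4 := by
  have h1 := maxShift_le hn2
  rw [coe_precision, one_div_mul_eq_div, div_le_iff₀ (by positivity)]
  nlinarith

def randomizedMachine (c n₀ : ℕ) : Machine fun n => Fin (5 * maxShift n) → Bool where
  prog _ := clusterProg
  rad n D := if n < n₀ then smallRadius c n * D else ((100 * maxShift n : ℕ) : ℝ≥0) * D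
  weight _ _ := 0
  delay i x := if i.n < n₀ then smallDelay i else (maxShift i.n - shift i.n x : ℕ) * (50 * i.D)

section Run

variable {V : Type} {N : Network V} {D ε R : ℝ≥0}

open Classical in
/-- Minus the distance to `v`, in units of `50 D`; small for nodes in other components. -/
def advantage (N : Network V) (D : ℝ≥0) (T : ℕ) (v u : V) : ℝ :=
  -- Unreachable nodes get `-(T + 2)`, which no shift up to `T` can lift to the nonnegative value of
  -- `v` itself.
  if ∃ d, Reach (N.link D fun _ => []) N.len u v d then
    -(sInf {d | Reach (N.link D fun _ => []) N.len u v d} : ℝ≥0) / (50 * D) else -(T + 2)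

/-- The leader is ahead by `50 D` at `v`. Passing to a node within `12 D` costs `24 D`, replacing
the infimum by a walk costs `D`, and the approximation at most `63 / 4 * D`, so no other root can
win nearby. -/
theorem Clustered.flag_eq_zero_of_hasLeader {T : ℕ} {g : V → ℕ} {f : Pointers V}
    {S : V → NodeState} {v : V}
    (hC : Clustered N D R (fun _ => []) f S)
    (hf : Answers (N.link D fun _ => []) N.len Set.univ (fun v => (T - g v : ℕ) * (50 * D)) ε R f)
    (hD : 0 < D) (hT : 1 ≤ T) (hε : (ε : ℝ) * T ≤ 1 / 4) (hg : ∀ u, g u ≤ T)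
    (hv : HasLeader (advantage N D T v) (fun k : ℕ => k) g) : (S v).flag = 0 := by
  by_contra hflag
  obtain ⟨w, e, hvw, he, hne⟩ := hC.bad v hflag
  obtain ⟨u, hu⟩ := hv
  have hs := N.link_symm D fun _ => []
  have hD' : (0 : ℝ) < D := hD
  have hgT : ∀ u, (g u : ℝ) ≤ T := fun u => by exact_mod_cast hg u
  have hvv : advantage N D T v v = 0 := by
    have h0 : Reach (N.link D fun _ => []) N.len v v 0 := .refl
    have : sInf {d | Reach (N.link D fun _ => []) N.len v v d} = 0 :=
      le_antisymm (csInf_le' h0) zero_le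
    rw [advantage, if_pos ⟨0, h0⟩, this]
    simp
  have hnn : 0 ≤ (g u : ℝ) + advantage N D T v u := by
    by_cases huv : v = u
    · rw [← huv, hvv]; positivity
    · have := hu v huv
      rw [hvv] at this
      have : (0 : ℝ) ≤ g v := Nat.cast_nonneg _
      linarith
  have hex : ∃ d, Reach (N.link D fun _ => []) N.len u v d := by
    by_contra hex
    rw [advantage, if_neg hex] at hnn
    linarith [hgT u]
  set σ : V → ℝ≥0 := fun u => sInf {d | Reach (N.link D fun _ => []) N.len u v d}
  have hσ : ∀ u d, Reach (N.link D fun _ => []) N.len u v d → σ u ≤ d := fun u d h => csInf_le' h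
  have hadv : ∀ u, (∃ d, Reach (N.link D fun _ => []) N.len u v d) →
      advantage N D T v u * (50 * D) = -σ u := by
    intro u h
    rw [advantage, if_pos h, div_mul_cancel₀ _ (by positivity)]
  obtain ⟨d₀, hd₀, hlt⟩ := exists_lt_of_csInf_lt
    (s := {d | Reach (N.link D fun _ => []) N.len u v d})
    hex (lt_add_of_pos_right (σ u) hD)
  have key : ∀ w e, Reach (N.link D fun _ => []) N.len v w e → e ≤ 12 * D → ∀ q d,
      RootPath f N.len w q d → q = u := by
    intro w e hvw he q d hq
    by_contra hqu
    have ha := NNReal.coe_le_coe.2 (hf.approx w q d hq u trivial _ (hd₀.trans hvw))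
    simp only [NNReal.coe_add, NNReal.coe_mul, NNReal.coe_natCast, Nat.cast_sub (hg q),
      Nat.cast_sub (hg u), NNReal.coe_one, NNReal.coe_ofNat] at ha
    have hqv : Reach (N.link D fun _ => []) N.len q v (d + e) :=
      ((hq.reach hf.parent).symm hs).trans (hvw.symm hs)
    have h1 := hu q hqu
    have h2 : ((g q : ℝ) + advantage N D T v q + 1) * (50 * D) ≤
        (g u + advantage N D T v u) * (50 * D) := by gcongr
    have h3 : 0 ≤ ((g u : ℝ) + advantage N D T v u) * (50 * D) := by positivity
    have h4 := hadv u hex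
    have h5 := hadv q ⟨_, hqv⟩
    have h6 : (σ q : ℝ) ≤ d + e := by exact_mod_cast hσ q _ hqv
    have h7 : (d₀ : ℝ) ≤ σ u + D := by exact_mod_cast hlt.le
    have h8 : (e : ℝ) ≤ 12 * D := by exact_mod_cast he
    have hT' : (1 : ℝ) ≤ T := by exact_mod_cast hT
    rw [add_mul, h4] at h3
    rw [add_mul, add_mul, add_mul, h4, h5] at h2
    -- `63 = 50 + 12 + 1`; the leader has `σ u ≤ g u * (50 * D)`, so its delay and distance together
    -- fit into `T * (50 * D)`.
    have h9 : (ε : ℝ) * ((T - g u) * (50 * D) + (d₀ + e)) ≤ 63 / 4 * D := by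
      calc (ε : ℝ) * ((T - g u) * (50 * D) + (d₀ + e)) ≤ ε * (T * (63 * D)) := by
            have := ε.coe_nonneg
            gcongr
            nlinarith
        _ = ε * T * (63 * D) := by ring
        _ ≤ 1 / 4 * (63 * D) := by gcongr
        _ = 63 / 4 * D := by ring
    nlinarith
  obtain ⟨q, d, hq, -⟩ := hC.rooted w
  obtain ⟨q', d', hq', -⟩ := hC.rooted v
  refine hne ?_
  rw [hC.hist w q d hq, hC.hist v q' d' hq', key w e hvw he q d hq, key v 0 .refl zero_le q' d' hq']

end Run

theorem toOuterMeasure_uniform_le {Ω : Type} [Fintype Ω] [Nonempty Ω] {s t : Set Ω} (hst : s ⊆ t)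
    [Fintype t] {k : ℕ} (hk : 0 < k) (h : k * Fintype.card t ≤ Fintype.card Ω) :
    (PMF.uniformOfFintype Ω).toOuterMeasure s ≤ 1 / k := by
  refine (MeasureTheory.measure_mono hst).trans ?_
  rw [PMF.toOuterMeasure_uniformOfFintype_apply]
  have hΩ : 0 < Fintype.card Ω := Fintype.card_pos
  rw [ENNReal.div_le_iff (by exact_mod_cast hΩ.ne') (by simp),
    ← ENNReal.mul_div_right_comm, one_mul,
    ENNReal.le_div_iff_mul_le (by left; exact_mod_cast hk.ne') (by simp), mul_comm]
  exact_mod_cast h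

open Classical in
theorem exists_randomized (c : ℕ) : ∃ (K₀ : ℕ) (m : ℕ → ℕ) (A : Alg fun n => Fin (m n) → Bool),
    ∀ K ≥ K₀, ∀ (V : Type) [Fintype V] (N : Network V), 2 ≤ Fintype.card V →
      (∀ v, N.ident v ≤ Fintype.card V ^ c) → ∀ O : Oracle N, IsDistOracle N O →
      ∀ D : ℝ≥0, 0 < D →
        (∀ ω : V → Fin (m (Fintype.card V)) → Bool, ComputesPadded N A O D ω K) ∧
        ∀ v : V, (PMF.uniformOfFintype (V → Fin (m (Fintype.card V)) → Bool)).toOuterMeasure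
          {ω | v ∈ outBad N A O D ω K} ≤ 1 / 10 := by
  classical
  obtain ⟨n₀, hn₀⟩ := exists_forall_le_logb 896
  refine ⟨(c + 5 + 2 * smallRadius c n₀) + 44800, fun n => 5 * maxShift n,
    (randomizedMachine c n₀).alg, fun K hK V _ N hn hid O hO D hD => ?_⟩
  rcases lt_or_ge (Fintype.card V) n₀ with hlt | hge
  · have h := fun ω => Machine.computesPadded_small (m := randomizedMachine c n₀) (x := ω)
      (c := c) (K := K) hO hn hid hD hlt.le (by omega) rfl
      (by simp [randomizedMachine, hlt]) fun v => by simp [randomizedMachine, localInput, hlt]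
    refine ⟨fun ω => (h ω).1, fun v => ?_⟩
    have : {ω | v ∈ outBad N (randomizedMachine c n₀).alg O D ω K} = ∅ :=
      Set.eq_empty_iff_forall_notMem.2 fun ω hω => by
        rw [Set.mem_ofPred_eq, (h ω).2] at hω
        exact hω
    rw [this]
    simp
  · have hL := hn₀ _ hge
    set T := maxShift (Fintype.card V) with hT
    have hT1 : 1 ≤ T := by rw [hT, maxShift]; omega
    obtain ⟨hγ₀, hγ₁, hγ₂⟩ := (exists_geometric T).choose_spec
    change ∀ y, shift (Fintype.card V) y ≤ T at hγ₀
    have hrad : (randomizedMachine c n₀).rad (Fintype.card V) D = _ := if_neg (not_lt.2 hge)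
    have hmain : ∀ ω : V → Fin (5 * T) → Bool,
        ComputesPadded N (randomizedMachine c n₀).alg O D ω K ∧
        ∃ S : V → NodeState, (∀ v, HasLeader (advantage N D T v) (shift (Fintype.card V)) ω →
          (S v).flag = 0) ∧ outBad N (randomizedMachine c n₀).alg O D ω K =
            {v | (S v).flag ≠ 0} := by
      intro ω
      refine Machine.computesPadded hD
        (length_le_timeLimit hn (by change 5 ≤ K; omega)) ?_ ?_
      · have h1 := maxShift_le hn
        have h2 := one_le_logb hn
        have hK' : (44800 : ℝ) ≤ K := by exact_mod_cast (by omega : 44800 ≤ K)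
        rw [hrad, NNReal.coe_mul, ← mul_assoc, logCard, NNReal.coe_natCast, Nat.cast_mul]
        refine mul_le_mul_of_nonneg_right ?_ D.coe_nonneg
        rw [← hT] at h1
        generalize Real.logb 2 (Fintype.card V) = L at *
        have hLL : L ≤ L ^ 3 := le_self_pow₀ h2 (by norm_num)
        have h3 : 44800 * L ≤ K * L ^ 3 := mul_le_mul hK' hLL (by linarith) (Nat.cast_nonneg K)
        push_cast
        linarith
      · have hrep := represents_init (N := N) (randomizedMachine c n₀) D ω
        have hδ : (fun v => (randomizedMachine c n₀).delay (localInput N D v) (ω v)) =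
            fun v => ((T - shift (Fintype.card V) (ω v) : ℕ) : ℝ≥0) * (50 * D) :=
          funext fun v => if_neg (not_lt.2 hge)
        rw [hδ] at hrep
        refine (Machine.achieves_clusterProg hO hrep hD (precision_le_one hn) ?_
          (Nat.one_le_pow _ _ (by omega)) (fun v => (hid v).trans
            (Nat.pow_le_pow_right (by omega) (by omega))) fun v => ?_).mono ?_
        · rw [hrad]
          gcongr
          exact_mod_cast (by omega : 10 ≤ 100 * T)
        · refine ⟨v, trivial, 0, .refl, ?_⟩
          rw [hrad]
          calc 2 * (((T - shift (Fintype.card V) (ω v) : ℕ) : ℝ≥0) * (50 * D) + 0)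
              ≤ 2 * ((T : ℝ≥0) * (50 * D) + 0) := by
                gcongr
                exact Nat.sub_le _ _
            _ = ((100 * T : ℕ) : ℝ≥0) * D := by push_cast; ring
        · rintro - S ⟨f, hf, hC⟩
          exact ⟨⟨_, f, hC⟩, fun v hv => hC.flag_eq_zero_of_hasLeader hf hD hT1
            (precision_mul_maxShift_le hL hn) (fun u => hγ₀ _) hv⟩
    refine ⟨fun ω => (hmain ω).1, fun v => ?_⟩
    have : Nonempty V := ⟨v⟩
    have hcard := card_not_hasLeader (advantage N D T v) (shift (Fintype.card V)) N.ident hγ₀ hγ₁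
      (by
        refine le_trans (Nat.mul_le_mul_left _ hγ₂) ((maxShift_tail _).trans (le_of_eq ?_))
        rw [Fintype.card_fun, Fintype.card_bool, Fintype.card_fin, pow_mul, ← hT]
        norm_num)
    have := toOuterMeasure_uniform_le (k := 10)
      (s := {ω | v ∈ outBad N (randomizedMachine c n₀).alg O D ω K})
      (t := {ω | ¬ HasLeader (advantage N D T v) (shift (Fintype.card V)) ω})
      (fun ω hω hl => by
        obtain ⟨S, hS, e⟩ := (hmain ω).2
        rw [Set.mem_ofPred_eq, e] at hω
        exact hω (hS v hl)) (by norm_num)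
      (le_trans (Nat.mul_le_mul_right _ (by norm_num)) hcard)
    exact_mod_cast this

end LowDiam

end

open LowDiam in
open Classical in
theorem mainTheorem5 (c : ℕ) : ∃ K : ℕ,
    (∃ A : Alg (fun _ => ℕ),
      ∀ (V : Type) [Fintype V] (N : Network V), 2 ≤ Fintype.card V →
        (∀ v, N.ident v ≤ Fintype.card V ^ c) →
        ∀ O : Oracle N, IsDistOracle N O →
        ∀ D : ℝ≥0, 0 < D →
        ∀ μ : V → ℕ, (∀ v, μ v ≤ Fintype.card V ^ c) →
          ComputesPadded N A O D μ K ∧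
          ∑ v with v ∈ outBad N A O D μ K, (μ v : ℝ) ≤ 1 / 10 * ∑ v, (μ v : ℝ)) ∧
    (∃ (m : ℕ → ℕ) (A : Alg (fun n => Fin (m n) → Bool)),
      ∀ (V : Type) [Fintype V] (N : Network V), 2 ≤ Fintype.card V →
        (∀ v, N.ident v ≤ Fintype.card V ^ c) →
        ∀ O : Oracle N, IsDistOracle N O →
        ∀ D : ℝ≥0, 0 < D →
          (∀ ω : V → Fin (m (Fintype.card V)) → Bool, ComputesPadded N A O D ω K) ∧
          ∀ v : V, (PMF.uniformOfFintype (V → Fin (m (Fintype.card V)) → Bool)).toOuterMeasure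
            {ω | v ∈ outBad N A O D ω K} ≤ 1 / 10) := by
  obtain ⟨K₁, A₁, h₁⟩ := exists_deterministic c
  obtain ⟨K₂, m, A₂, h₂⟩ := exists_randomized c
  exact ⟨max K₁ K₂, ⟨A₁, h₁ _ (le_max_left _ _)⟩, m, A₂, h₂ _ (le_max_right _ _)⟩
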